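/- Let $\mathcal H$ be a real Hilbert space. For a continuous symmetric bilinear form $B$ on $\mathcal H$ let $T:\mathcal H\to\mathcal H$ be the bounded self-adjoint operator with $B(x,y)=\langle Tx,y\rangle$ for all $x,y$; $B$ is called a *symmetric Fredholm form* if $T$ is a Fredholm operator. For a bounded self-adjoint operator $T$, let $\mathcal H=V^-(T)\oplus V^+(T)\oplus\operatorname{Ker}T$ be the unique orthogonal splitting into closed $T$-invariant subspaces such that $\langle Tx,x\rangle<0$ for $0\ne x\in V^-(T)$ and $\langle Tx,x\rangle>0$ for $0\neq x\in V^+(T)$; $V^-(T)$ is the *negative eigenspace* of $T$. For a subspace $\mathcal W$, $P_{\mathcal W}$ denotes the orthogonal projection onto $\mathcal W$ (if closed), $\mathcal W^{\perp_B}=\{x\in\mathcal H: B(x,y)=0\ \forall y\in\mathcal W\}$, and the Morse index $n_-(B|_{\mathcal W})$ is the supremum of the dimensions of the subspaces of $\mathcal W$ on which $B$ is negative definite. Two closed subspaces $\mathcal U,\mathcal W$ of $\mathcal H$ are *commensurable* if $P_{\mathcal U}-P_{\mathcal W}$ is compact; then $\mathcal U\cap\mathcal W^\perp$ and $\mathcal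 W\cap\mathcal U^\perp$ are finite dimensional, and the *relative dimension* is $\dim(\mathcal U,\mathcal W)=\dim(\mathcal U\cap\mathcal W^\perp)-\dim(\mathcal W\cap\mathcal U^\perp)$. **Proposition.** Let $B$ be a symmetric Fredholm form on $\mathcal H$ with associated operator $T$, let $\mathcal V$ be a closed subspace of $\mathcal H$ of finite codimension, and let $\widetilde T=P_{\mathcal V}\circ T|_{\mathcal V}:\mathcal V\to\mathcal V$ be the operator associated with $B|_{\mathcal V\times\mathcal V}$. Then $B|_{\mathcal V\times\mathcal V}$ is a symmetric Fredholm form on $\mathcal V$, the closed subspaces $V^-(T)$ and $V^-(\widetilde T)$ of $\mathcal H$ are commensurable, the quantities $n_-(B|_{\mathcal V^{\perp_B}})$, $\dim(\mathcal V\cap\mathcal V^{\perp_B})$ and $\dim(\mathcal V\cap\operatorname{Ker}T)$ are finite, and $$\dim\big(V^-(T),V^-(\widetilde T)\big)=n_-\big(B|_{\mathcal V^{\perp_B}}\big)+\dim\big(\mathcal V\cap\mathcal V^{\perp_B}\big)-\dim\big(\mathcal V\cap\operatorname{Ker}T\big).$$ -/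

import Mathlib

open scoped InnerProductSpace

noncomputable section

/-! ### Continuous bilinear forms on a real Hilbert space -/

/-- The operator `T` associated with a continuous bilinear form `B`: the unique bounded operator
with `B x y = ⟪T x, y⟫` for all `x, y`. -/
def associatedOperator {H : Type*} [NormedAddCommGroup H] [InnerProductSpace ℝ H]
    [CompleteSpace H] (B : H →L[ℝ] H →L[ℝ] ℝ) : H →L[ℝ] H :=
  InnerProductSpace.continuousLinearMapOfBilin (𝕜 := ℝ) B

theorem inner_associatedOperator {H : Type*} [NormedAddCommGroup H] [InnerProductSpace ℝ H]
    [CompleteSpace H] (B : H →L[ℝ] H →L[ℝ] ℝ) (x y : H) :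
    ⟪associatedOperator B x, y⟫_ℝ = B x y :=
  InnerProductSpace.continuousLinearMapOfBilin_apply (𝕜 := ℝ) B x y

/-- A symmetric Fredholm form: a symmetric continuous bilinear form whose associated operator is
Fredholm. -/
structure IsSymmetricFredholmForm {H : Type*} [NormedAddCommGroup H] [InnerProductSpace ℝ H]
    [CompleteSpace H] (B : H →L[ℝ] H →L[ℝ] ℝ) : Prop where
  symm : ∀ x y, B x y = B y x
  fredholm : (associatedOperator B).IsFredholm

/-- The restriction `B|_{W × W}` of a bilinear form to a subspace `W`. -/
def restrictForm {H : Type*} [NormedAddCommGroup H] [InnerProductSpace ℝ H]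
    (B : H →L[ℝ] H →L[ℝ] ℝ) (W : Submodule ℝ H) : W →L[ℝ] W →L[ℝ] ℝ :=
  B.bilinearComp W.subtypeL W.subtypeL

instance ClosedSubmodule.completeSpace_toSubmodule {H : Type*} [NormedAddCommGroup H]
    [InnerProductSpace ℝ H] [CompleteSpace H] (V : ClosedSubmodule ℝ H) :
    CompleteSpace V.toSubmodule :=
  V.isClosed.completeSpace_coe

/-- The restricted operator `P_V ∘ T|_V : V → V`. -/
def restrictOperator {H : Type*} [NormedAddCommGroup H] [InnerProductSpace ℝ H]
    [CompleteSpace H] (T : H →L[ℝ] H) (V : ClosedSubmodule ℝ H) :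
    V.toSubmodule →L[ℝ] V.toSubmodule :=
  V.toSubmodule.orthogonalProjectionOnto ∘L T ∘L V.toSubmodule.subtypeL

/-- The restricted operator `P_V ∘ T|_V` is the operator associated with `B|_{V × V}`. -/
theorem associatedOperator_restrictForm {H : Type*} [NormedAddCommGroup H]
    [InnerProductSpace ℝ H] [CompleteSpace H] (B : H →L[ℝ] H →L[ℝ] ℝ)
    (V : ClosedSubmodule ℝ H) :
    associatedOperator (restrictForm B V.toSubmodule) =
      restrictOperator (associatedOperator B) V := by
  ext1 x
  refine ext_inner_right ℝ fun y => ?_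
  rw [inner_associatedOperator]
  change B x y = _
  rw [← inner_associatedOperator B]
  exact (Submodule.inner_orthogonalProjectionOnto_eq_of_mem_right y _).symm

/-- The `B`-orthogonal complement `{x | B x y = 0 for all y ∈ V}`. -/
def bilinOrthogonal {H : Type*} [NormedAddCommGroup H] [InnerProductSpace ℝ H]
    (B : H →L[ℝ] H →L[ℝ] ℝ) (V : Submodule ℝ H) : Submodule ℝ H where
  carrier := {x | ∀ y ∈ V, B x y = 0}
  zero_mem' := by simp
  add_mem' := by
    intro a b ha hb y hy
    simp [ha y hy, hb y hy]
  smul_mem' := by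
    intro c a ha y hy
    simp [ha y hy]

/-- The Morse index `n₋(B)`: the supremum of the dimensions of the subspaces on which `B` is
negative definite, as an element of `ℕ ∪ {∞}`. -/
def morseIndex {H : Type*} [NormedAddCommGroup H] [InnerProductSpace ℝ H]
    (B : H →L[ℝ] H →L[ℝ] ℝ) : ℕ∞ :=
  ⨆ W : {W : Submodule ℝ H // ∀ x ∈ W, x ≠ 0 → B x x < 0}, Cardinal.toENat (Module.rank ℝ W.1)

/-! ### The spectral splitting and the negative eigenspace -/

/-- `H = Vm ⊕ Vp ⊕ ker T` is an orthogonal splitting into closed `T`-invariant subspaces such that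
the form `⟪T x, y⟫` is negative definite on `Vm` and positive definite on `Vp`. -/
structure IsSpectralSplitting {H : Type*} [NormedAddCommGroup H] [InnerProductSpace ℝ H]
    (T : H →L[ℝ] H) (Vm Vp : ClosedSubmodule ℝ H) : Prop where
  ortho : Vm.toSubmodule ⟂ Vp.toSubmodule
  ortho_neg_ker : Vm.toSubmodule ⟂ T.ker
  ortho_pos_ker : Vp.toSubmodule ⟂ T.ker
  sup_eq_top : Vm.toSubmodule ⊔ Vp.toSubmodule ⊔ T.ker = ⊤
  map_neg : ∀ x ∈ Vm, T x ∈ Vm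
  map_pos : ∀ x ∈ Vp, T x ∈ Vp
  neg_def : ∀ x ∈ Vm, x ≠ 0 → ⟪T x, x⟫_ℝ < 0
  pos_def : ∀ x ∈ Vp, x ≠ 0 → 0 < ⟪T x, x⟫_ℝ

open Polynomial in
/-- Polynomials approximating `1 - √(1 - X)`. -/
def sqrtPoly : ℕ → ℝ[X]
  | 0 => 0
  | n + 1 => C (1 / 2) * (X + sqrtPoly n ^ 2)

open Polynomial in
theorem coeff_mul_nonneg_aux {p q : ℝ[X]} (hp : ∀ k, 0 ≤ p.coeff k) (hq : ∀ k, 0 ≤ q.coeff k)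
    (k : ℕ) : 0 ≤ (p * q).coeff k := by
  rw [coeff_mul]
  exact Finset.sum_nonneg fun i _ => mul_nonneg (hp _) (hq _)

open Polynomial in
theorem sqrtPoly_coeff_nonneg (n : ℕ) (k : ℕ) : 0 ≤ (sqrtPoly n).coeff k := by
  induction n generalizing k with
  | zero => simp [sqrtPoly]
  | succ n ih =>
    rw [sqrtPoly, coeff_C_mul, coeff_add, pow_two, coeff_X]
    have := coeff_mul_nonneg_aux ih ih k
    split_ifs <;> linarith

open Polynomial in
theorem sqrtPoly_succ_sub_coeff_nonneg (n : ℕ) (k : ℕ) :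
    0 ≤ (sqrtPoly (n + 1) - sqrtPoly n).coeff k := by
  induction n generalizing k with
  | zero =>
    have := sqrtPoly_coeff_nonneg 1 k
    simpa [sqrtPoly] using this
  | succ n ih =>
    have h : sqrtPoly (n + 2) - sqrtPoly (n + 1) = C (1 / 2) *
        ((sqrtPoly (n + 1) - sqrtPoly n) * (sqrtPoly (n + 1) + sqrtPoly n)) := by
      rw [sqrtPoly.eq_2 (n + 1)]
      conv_lhs => rw [sqrtPoly.eq_2 n]
      rw [sqrtPoly.eq_2 n]
      ring
    rw [h, coeff_C_mul]
    have := coeff_mul_nonneg_aux ih (q := sqrtPoly (n + 1) + sqrtPoly n) (fun j => by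
      rw [coeff_add]
      exact add_nonneg (sqrtPoly_coeff_nonneg _ _) (sqrtPoly_coeff_nonneg _ _)) k
    linarith

open Polynomial in
theorem sqrtPoly_sub_coeff_nonneg {m n : ℕ} (h : m ≤ n) (k : ℕ) :
    0 ≤ (sqrtPoly n - sqrtPoly m).coeff k := by
  induction n, h using Nat.le_induction with
  | base => simp
  | succ n _ ih =>
    have := sqrtPoly_succ_sub_coeff_nonneg n k
    rw [coeff_sub] at *
    linarith

open Polynomial in
theorem sqrtPoly_eval_one_mem (n : ℕ) : 0 ≤ (sqrtPoly n).eval 1 ∧ (sqrtPoly n).eval 1 ≤ 1 := by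
  induction n with
  | zero => simp [sqrtPoly]
  | succ n ih =>
    simp only [sqrtPoly, eval_mul, eval_C, eval_add, eval_X, eval_pow]
    constructor <;> nlinarith [ih.1, ih.2]

open Polynomial in
theorem norm_aeval_le_eval_one {H : Type*} [NormedAddCommGroup H] [InnerProductSpace ℝ H]
    {A : H →L[ℝ] H} (hA : ‖A‖ ≤ 1) {p : ℝ[X]} (hp : ∀ k, 0 ≤ p.coeff k) :
    ‖aeval A p‖ ≤ p.eval 1 := by
  rw [aeval_eq_sum_range, eval_eq_sum_range]
  refine (norm_sum_le _ _).trans (Finset.sum_le_sum fun i _ => ?_)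
  rw [norm_smul, Real.norm_of_nonneg (hp i), one_pow]
  refine mul_le_mul_of_nonneg_left ?_ (hp i)
  rcases i with _ | i
  · rw [pow_zero]
    exact ContinuousLinearMap.norm_id_le
  · exact (norm_pow_le' A i.succ_pos).trans (pow_le_one₀ (norm_nonneg _) hA)

open Polynomial in
theorem isSelfAdjoint_aeval_aux {H : Type*} [NormedAddCommGroup H] [InnerProductSpace ℝ H]
    [CompleteSpace H] {A : H →L[ℝ] H} (hA : IsSelfAdjoint A) (p : ℝ[X]) :
    IsSelfAdjoint (aeval A p) := by
  induction p using Polynomial.induction_on' with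
  | add p q hp hq => rw [map_add]; exact hp.add hq
  | monomial n a =>
    rw [aeval_monomial, ← Algebra.smul_def]
    exact IsSelfAdjoint.smul (IsSelfAdjoint.all a) (hA.pow n)

open Polynomial in
/-- The positive square root of `T²` for a self-adjoint operator `T`. -/
theorem exists_absOperator {H : Type*} [NormedAddCommGroup H] [InnerProductSpace ℝ H]
    [CompleteSpace H] {T : H →L[ℝ] H} (hT : IsSelfAdjoint T) :
    ∃ S : H →L[ℝ] H, IsSelfAdjoint S ∧ (∀ x, 0 ≤ ⟪S x, x⟫_ℝ) ∧ S * S = T * T ∧ S * T = T * S ∧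
      ∀ W : ClosedSubmodule ℝ H, (∀ x ∈ W, T x ∈ W) → ∀ x ∈ W, S x ∈ W := by
  set M : ℝ := ‖T‖ + 1 with hM
  have hM0 : 0 < M := by positivity
  have hTs : ∀ x y, ⟪T x, y⟫_ℝ = ⟪x, T y⟫_ℝ := fun x y =>
    ((ContinuousLinearMap.isSelfAdjoint_iff_isSymmetric.1 hT) x y)
  have hTM : ∀ x, ‖T x‖ ≤ M * ‖x‖ := fun x =>
    (T.le_opNorm x).trans (mul_le_mul_of_nonneg_right (by linarith) (norm_nonneg _))
  set A : H →L[ℝ] H := 1 - (M⁻¹ ^ 2) • (T * T) with hAdef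
  have hAs : IsSelfAdjoint A := by
    refine (IsSelfAdjoint.one _).sub (IsSelfAdjoint.smul (IsSelfAdjoint.all _) ?_)
    rw [← pow_two]; exact hT.pow 2
  have hA1 : ‖A‖ ≤ 1 := by
    refine ContinuousLinearMap.opNorm_le_bound _ zero_le_one fun x => ?_
    rw [one_mul]
    refine le_of_sq_le_sq ?_ (norm_nonneg _)
    have e : A x = x - (M⁻¹ ^ 2) • T (T x) := by simp [hAdef]
    rw [e, norm_sub_sq_real, inner_smul_right, ← hTs, real_inner_self_eq_norm_sq, norm_smul]
    have h1 : ‖T (T x)‖ ^ 2 ≤ (M * ‖T x‖) ^ 2 := pow_le_pow_left₀ (norm_nonneg _) (hTM _) 2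
    rw [Real.norm_of_nonneg (by positivity)]
    have h2 : (M⁻¹ ^ 2 * ‖T (T x)‖) ^ 2 ≤ M⁻¹ ^ 2 * ‖T x‖ ^ 2 := by
      calc (M⁻¹ ^ 2 * ‖T (T x)‖) ^ 2 = M⁻¹ ^ 4 * ‖T (T x)‖ ^ 2 := by ring
        _ ≤ M⁻¹ ^ 4 * (M * ‖T x‖) ^ 2 := by gcongr
        _ = M⁻¹ ^ 2 * ‖T x‖ ^ 2 := by field_simp
    have h3 : 0 ≤ M⁻¹ ^ 2 * ‖T x‖ ^ 2 := by positivity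
    linarith
  -- the approximations converge
  have hmono : Monotone fun n => (sqrtPoly n).eval 1 := by
    intro m n hmn
    have : 0 ≤ (sqrtPoly n - sqrtPoly m).eval 1 := by
      rw [eval_eq_sum_range]
      exact Finset.sum_nonneg fun i _ => by simpa using sqrtPoly_sub_coeff_nonneg hmn i
    rw [eval_sub] at this
    simpa using this
  have hcs : CauchySeq fun n => (sqrtPoly n).eval (1 : ℝ) :=
    (tendsto_atTop_ciSup hmono ⟨1, by rintro _ ⟨n, rfl⟩; exact (sqrtPoly_eval_one_mem n).2⟩).cauchySeq
  have hdist : ∀ m n, ‖aeval A (sqrtPoly m) - aeval A (sqrtPoly n)‖ ≤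
      |(sqrtPoly m).eval 1 - (sqrtPoly n).eval 1| := by
    have key : ∀ m n, m ≤ n → ‖aeval A (sqrtPoly n) - aeval A (sqrtPoly m)‖ ≤
      |(sqrtPoly n).eval 1 - (sqrtPoly m).eval 1| := by
      intro m n hmn
      rw [← map_sub, ← eval_sub]
      exact (norm_aeval_le_eval_one hA1 (sqrtPoly_sub_coeff_nonneg hmn)).trans (le_abs_self _)
    intro m n
    rcases le_total m n with h | h
    · rw [norm_sub_rev, abs_sub_comm]; exact key m n h
    · exact key n m h
  have hcs' : CauchySeq fun n => aeval A (sqrtPoly n) := by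
    rw [Metric.cauchySeq_iff] at hcs ⊢
    intro ε hε
    obtain ⟨N, hN⟩ := hcs ε hε
    refine ⟨N, fun m hm n hn => ?_⟩
    have h1 := hN m hm n hn
    rw [dist_eq_norm] at *
    exact (hdist m n).trans_lt h1
  obtain ⟨Y, hY⟩ := cauchySeq_tendsto_of_complete hcs'
  have hYs : IsSelfAdjoint Y := by
    have h1 := (continuous_star.tendsto Y).comp hY
    refine tendsto_nhds_unique (h1.congr fun n => ?_) hY
    exact isSelfAdjoint_aeval_aux hAs _
  have hY1 : ‖Y‖ ≤ 1 := by
    refine le_of_tendsto hY.norm (Filter.Eventually.of_forall fun n => ?_)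
    exact (norm_aeval_le_eval_one hA1 (sqrtPoly_coeff_nonneg n)).trans (sqrtPoly_eval_one_mem n).2
  have hYeq : Y = (1 / 2 : ℝ) • (A + Y * Y) := by
    have h1 := (Filter.tendsto_add_atTop_iff_nat 1).2 hY
    have h2 : Filter.Tendsto (fun n => (1 / 2 : ℝ) • (A + aeval A (sqrtPoly n) *
        aeval A (sqrtPoly n))) Filter.atTop (nhds ((1 / 2 : ℝ) • (A + Y * Y))) :=
      (tendsto_const_nhds.add (hY.mul hY)).const_smul _
    refine tendsto_nhds_unique h1 (h2.congr fun n => ?_)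
    rw [sqrtPoly, map_mul, aeval_C, ← Algebra.smul_def, map_add, aeval_X, map_pow, pow_two]
  have hYT : Y * T = T * Y := by
    refine tendsto_nhds_unique (hY.mul_const T) ((hY.const_mul T).congr fun n => ?_)
    have hAT : Commute T A := by
      rw [hAdef]
      refine (Commute.one_right T).sub_right (Commute.smul_right ?_ _)
      exact (Commute.refl T).mul_right (Commute.refl T)
    induction sqrtPoly n using Polynomial.induction_on' with
    | add p q hp hq => rw [map_add, mul_add, add_mul, hp, hq]
    | monomial n a =>
      rw [aeval_monomial]
      exact ((Algebra.commute_algebraMap_right a T).mul_right (hAT.pow_right n)).eq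
  have hYW : ∀ W : ClosedSubmodule ℝ H, (∀ x ∈ W, T x ∈ W) → ∀ x ∈ W, Y x ∈ W := by
    intro W hW x hx
    have hAW : ∀ z ∈ W, A z ∈ W := by
      intro z hz
      have e : A z = z - (M⁻¹ ^ 2) • T (T z) := by simp [hAdef]
      rw [e]
      exact W.toSubmodule.sub_mem hz (W.toSubmodule.smul_mem _ (hW _ (hW _ hz)))
    have hAn : ∀ n : ℕ, ∀ z ∈ W, (A ^ n) z ∈ W := by
      intro n
      induction n with
      | zero => intro z hz; simpa using hz
      | succ n ih => intro z hz; rw [pow_succ]; exact ih _ (hAW z hz)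
    have hlim : Filter.Tendsto (fun n => aeval A (sqrtPoly n) x) Filter.atTop (nhds (Y x)) :=
      ((ContinuousLinearMap.apply ℝ H x).continuous.tendsto Y).comp hY
    refine W.isClosed.mem_of_tendsto hlim (Filter.Eventually.of_forall fun n => ?_)
    change aeval A (sqrtPoly n) x ∈ W.toSubmodule
    rw [aeval_eq_sum_range, sum_apply]
    refine W.toSubmodule.sum_mem fun i _ => ?_
    exact W.toSubmodule.smul_mem _ (hAn i x hx)
  refine ⟨M • (1 - Y), (IsSelfAdjoint.all M).smul ((IsSelfAdjoint.one _).sub hYs), ?_, ?_, ?_, ?_⟩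
  · intro x
    have e : (M • (1 - Y)) x = M • (x - Y x) := by simp
    rw [e, inner_smul_left, inner_sub_left, real_inner_self_eq_norm_sq]
    have h1 : ⟪Y x, x⟫_ℝ ≤ ‖Y x‖ * ‖x‖ := real_inner_le_norm _ _
    have h2 : ‖Y x‖ ≤ 1 * ‖x‖ := (Y.le_opNorm x).trans
      (mul_le_mul_of_nonneg_right hY1 (norm_nonneg _))
    have h3 := mul_le_mul_of_nonneg_right h2 (norm_nonneg x)
    refine mul_nonneg hM0.le ?_
    nlinarith
  · have h1 : (1 - Y) * (1 - Y) = (M⁻¹ ^ 2) • (T * T) := by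
      have h2 : (2 : ℝ) • Y = A + Y * Y := by
        conv_lhs => rw [hYeq]
        rw [smul_smul]; norm_num
      have h3 : (1 - Y) * (1 - Y) = 1 - (2 : ℝ) • Y + Y * Y := by
        rw [two_smul]; noncomm_ring
      rw [h3, h2, hAdef]; abel
    rw [smul_mul_smul_comm, h1, smul_smul]
    rw [show M * M * M⁻¹ ^ 2 = 1 by field_simp, one_smul]
  · rw [smul_mul_assoc, mul_smul_comm, sub_mul, mul_sub, one_mul, mul_one, hYT]
  · intro W hW x hx
    have e : (M • (1 - Y)) x = M • (x - Y x) := by simp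
    rw [e]
    exact W.toSubmodule.smul_mem _ (W.toSubmodule.sub_mem hx (hYW W hW x hx))

/-- Every self-adjoint operator has a spectral splitting, and only one. -/
theorem existsUnique_isSpectralSplitting {H : Type*} [NormedAddCommGroup H]
    [InnerProductSpace ℝ H] [CompleteSpace H] {T : H →L[ℝ] H} (hT : IsSelfAdjoint T) :
    ∃! p : ClosedSubmodule ℝ H × ClosedSubmodule ℝ H, IsSpectralSplitting T p.1 p.2 := by
  have hTs : ∀ x y, ⟪T x, y⟫_ℝ = ⟪x, T y⟫_ℝ := fun x y =>
    ((ContinuousLinearMap.isSelfAdjoint_iff_isSymmetric.1 hT) x y)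
  obtain ⟨S, hS, hpos, hSS, hST, hSW⟩ := exists_absOperator hT
  have hSs : ∀ x y, ⟪S x, y⟫_ℝ = ⟪x, S y⟫_ℝ := fun x y =>
    ((ContinuousLinearMap.isSelfAdjoint_iff_isSymmetric.1 hS) x y)
  have hSS' : ∀ x, S (S x) = T (T x) := fun x => by
    simpa using congrArg (fun F : H →L[ℝ] H => F x) hSS
  have hST' : ∀ x, S (T x) = T (S x) := fun x => by
    simpa using congrArg (fun F : H →L[ℝ] H => F x) hST
  have hSpos : ∀ x, ⟪S x, x⟫_ℝ = 0 → S x = 0 := by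
    intro x hx
    by_contra hne
    have hn : 0 < ‖S x‖ ^ 2 := by positivity
    set c := ⟪S (S x), S x⟫_ℝ with hc
    have hc0 : 0 ≤ c := hpos _
    -- a small negative multiple contradicts positivity
    have h' : ∀ s : ℝ, 0 ≤ 2 * s * ‖S x‖ ^ 2 + s ^ 2 * c := by
      intro s
      have h1 := hpos (x + s • S x)
      have e1 : ⟪S (x + s • S x), x + s • S x⟫_ℝ = 2 * s * ‖S x‖ ^ 2 + s ^ 2 * c := by
        simp only [map_add, map_smul, inner_add_left, inner_add_right, inner_smul_left,
          inner_smul_right, hx, hSs (S x) x, real_inner_self_eq_norm_sq, ← hc]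
        simp
        ring
      rwa [e1] at h1
    have h2 := h' (-(‖S x‖ ^ 2 / (c + 1)))
    have e2 : 2 * (-(‖S x‖ ^ 2 / (c + 1))) * ‖S x‖ ^ 2 + (-(‖S x‖ ^ 2 / (c + 1))) ^ 2 * c =
        -((‖S x‖ ^ 2) ^ 2 / (c + 1)) * (2 - c / (c + 1)) := by
      field_simp
      ring
    rw [e2] at h2
    have h3 : 0 < (‖S x‖ ^ 2) ^ 2 / (c + 1) := by positivity
    have h4 : c / (c + 1) < 1 := by rw [div_lt_one (by linarith)]; linarith
    nlinarith
  have hS0 : ∀ x, S x = 0 → x ∈ T.ker := by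
    intro x hx
    have h1 : ⟪T x, T x⟫_ℝ = 0 := by rw [hTs, ← hSS', hx]; simp
    exact inner_self_eq_zero.1 h1
  have hT0 : ∀ x, T x = 0 → S x = 0 := by
    intro x hx
    have h1 : ⟪S x, S x⟫_ℝ = 0 := by rw [hSs, hSS', hx]; simp
    exact inner_self_eq_zero.1 h1
  -- the two components
  obtain ⟨Vm, memVm⟩ : ∃ V : ClosedSubmodule ℝ H, ∀ x, x ∈ V ↔ S x + T x = 0 ∧ x ∈ T.kerᗮ :=
    ⟨⟨(S + T).ker ⊓ T.kerᗮ, (S + T).isClosed_ker.inter (Submodule.isClosed_orthogonal _)⟩,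
      fun _ => Iff.rfl⟩
  obtain ⟨Vp, memVp⟩ : ∃ V : ClosedSubmodule ℝ H, ∀ x, x ∈ V ↔ S x - T x = 0 ∧ x ∈ T.kerᗮ :=
    ⟨⟨(S - T).ker ⊓ T.kerᗮ, (S - T).isClosed_ker.inter (Submodule.isClosed_orthogonal _)⟩,
      fun _ => Iff.rfl⟩
  have hTk : ∀ x, T x ∈ T.kerᗮ := by
    intro x
    rw [Submodule.mem_orthogonal]
    intro u hu
    rw [← hTs, show T u = 0 from hu, inner_zero_left]
  have hker : ∀ x, T x = 0 → x ∈ T.kerᗮ → x = 0 := fun x hx hx' =>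
    inner_self_eq_zero.1 ((Submodule.mem_orthogonal _ _).1 hx' x hx)
  have : CompleteSpace T.ker := T.isClosed_ker.completeSpace_coe
  have main : IsSpectralSplitting T Vm Vp := by
    refine ⟨?_, ?_, ?_, ?_, ?_, ?_, ?_, ?_⟩
    · rw [Submodule.isOrtho_iff_inner_eq]
      intro x hx y hy
      obtain ⟨hx1, hx2⟩ := (memVm x).1 hx
      obtain ⟨hy1, hy2⟩ := (memVp y).1 hy
      have hzero : ∀ v ∈ Vp, ⟪T x, v⟫_ℝ = 0 := by
        intro v hv
        have hv1 := ((memVp v).1 hv).1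
        have a1 : ⟪S x, v⟫_ℝ = ⟪x, S v⟫_ℝ := hSs x v
        rw [eq_neg_of_add_eq_zero_left hx1, sub_eq_zero.1 hv1, ← hTs, inner_neg_left] at a1
        linarith
      have hTV : ∀ v ∈ Vp, T v ∈ Vp := by
        intro v hv
        refine (memVp _).2 ⟨?_, hTk v⟩
        rw [hST', ← map_sub, ((memVp v).1 hv).1, map_zero]
      -- project `x` to the second component
      set u : H := Vp.toSubmodule.starProjection x with hu
      have huV : u ∈ Vp := Submodule.starProjection_apply_mem _ _
      have hxu : x - u ∈ Vp.toSubmoduleᗮ := Submodule.sub_starProjection_mem_orthogonal x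
      have hTu : T u = 0 := by
        have b1 : ⟪T u, T u⟫_ℝ = ⟪u, T (T u)⟫_ℝ := hTs _ _
        have b2 : ⟪x - u, T (T u)⟫_ℝ = 0 :=
          (Submodule.mem_orthogonal' _ _).1 hxu _ (hTV _ (hTV _ huV))
        have b3 : ⟪x, T (T u)⟫_ℝ = 0 := by rw [← hTs]; exact hzero _ (hTV _ huV)
        rw [inner_sub_left, b3] at b2
        exact inner_self_eq_zero (𝕜 := ℝ).1 (by linarith)
      have hu0 : u = 0 := hker u hTu ((memVp u).1 huV).2
      rw [hu0, sub_zero] at hxu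
      exact (Submodule.mem_orthogonal' _ _).1 hxu y hy
    · exact Submodule.isOrtho_iff_le.2 fun x hx => ((memVm x).1 hx).2
    · exact Submodule.isOrtho_iff_le.2 fun x hx => ((memVp x).1 hx).2
    · rw [eq_top_iff]
      intro x _
      have hk : T.ker.starProjection x ∈ T.ker := Submodule.starProjection_apply_mem _ _
      have hw : x - T.ker.starProjection x ∈ T.kerᗮ := Submodule.sub_starProjection_mem_orthogonal x
      set k := T.ker.starProjection x
      have ha : Vm.toSubmodule.starProjection (x - k) ∈ Vm :=
        Submodule.starProjection_apply_mem _ _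
      have hb := Vm.toSubmodule.sub_starProjection_mem_orthogonal (x - k)
      set a := Vm.toSubmodule.starProjection (x - k)
      have hbV : x - k - a ∈ Vp := by
        refine (memVp _).2 ⟨?_, Submodule.sub_mem _ hw ((memVm a).1 ha).2⟩
        refine ext_inner_right ℝ fun z => ?_
        have hz : S z - T z ∈ Vm := by
          refine (memVm _).2 ⟨by rw [map_sub, map_sub, hSS', hST']; abel, ?_⟩
          refine Submodule.sub_mem _ ?_ (hTk z)
          rw [Submodule.mem_orthogonal]
          intro u hu
          rw [← hSs, hT0 u hu, inner_zero_left]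
        rw [inner_zero_left, inner_sub_left, hSs, hTs, ← inner_sub_right]
        exact (Submodule.mem_orthogonal' _ _).1 hb _ hz
      have e : x = a + (x - k - a) + k := by abel
      rw [e]
      exact Submodule.add_mem_sup (Submodule.add_mem_sup ha hbV) hk
    · intro x hx
      refine (memVm _).2 ⟨?_, hTk x⟩
      rw [hST', ← map_add, ((memVm x).1 hx).1, map_zero]
    · intro x hx
      refine (memVp _).2 ⟨?_, hTk x⟩
      rw [hST', ← map_sub, ((memVp x).1 hx).1, map_zero]
    · intro x hx hx0
      obtain ⟨hx1, hx2⟩ := (memVm x).1 hx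
      rw [eq_neg_of_add_eq_zero_right hx1, inner_neg_left, neg_lt_zero]
      refine lt_of_le_of_ne (hpos x) fun h => hx0 (hker x ?_ hx2)
      exact hS0 x (hSpos x h.symm)
    · intro x hx hx0
      obtain ⟨hx1, hx2⟩ := (memVp x).1 hx
      rw [← sub_eq_zero.1 hx1]
      refine lt_of_le_of_ne (hpos x) fun h => hx0 (hker x ?_ hx2)
      exact hS0 x (hSpos x h.symm)
  refine ⟨(Vm, Vp), main, ?_⟩
  rintro ⟨Wm, Wp⟩ hW
  change IsSpectralSplitting T Wm Wp at hW
  have hm : ∀ x ∈ Wm, x ∈ Vm := by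
    intro x hx
    refine (memVm x).2 ⟨?_, hW.ortho_neg_ker.le hx⟩
    have hy : S x + T x ∈ Wm :=
      Wm.toSubmodule.add_mem (hSW Wm hW.map_neg x hx) (hW.map_neg x hx)
    by_contra hne
    have h1 := hW.neg_def _ hy hne
    have h2 : T (S x + T x) = S (S x + T x) := by
      rw [map_add, map_add, hSS', hST', add_comm]
    rw [h2] at h1
    exact absurd (hpos (S x + T x)) (not_le.2 h1)
  have hp : ∀ x ∈ Wp, x ∈ Vp := by
    intro x hx
    refine (memVp x).2 ⟨?_, hW.ortho_pos_ker.le hx⟩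
    have hy : S x - T x ∈ Wp :=
      Wp.toSubmodule.sub_mem (hSW Wp hW.map_pos x hx) (hW.map_pos x hx)
    by_contra hne
    have h1 := hW.pos_def _ hy hne
    have h2 : T (S x - T x) = - S (S x - T x) := by
      rw [map_sub, map_sub, hSS', hST', neg_sub]
    rw [h2, inner_neg_left] at h1
    exact absurd (hpos (S x - T x)) (not_le.2 (by linarith))
  have dec : ∀ v : H, v ∈ T.kerᗮ → ∃ a ∈ Wm, ∃ b ∈ Wp, v = a + b := by
    intro v hv
    have hv' : v ∈ Wm.toSubmodule ⊔ Wp.toSubmodule ⊔ T.ker := by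
      rw [hW.sup_eq_top]; trivial
    obtain ⟨w, hw, k, hk, rfl⟩ := Submodule.mem_sup.1 hv'
    obtain ⟨a, ha, b, hb, rfl⟩ := Submodule.mem_sup.1 hw
    have hk' : k = 0 := by
      refine hker k hk ?_
      have : k = (a + b + k) - (a + b) := by abel
      rw [this]
      exact Submodule.sub_mem _ hv
        (Submodule.add_mem _ (hW.ortho_neg_ker.le ha) (hW.ortho_pos_ker.le hb))
    exact ⟨a, ha, b, hb, by rw [hk', add_zero]⟩
  have disj : ∀ z, z ∈ Vm → z ∈ Vp → z = 0 := fun z h1 h2 =>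
    inner_self_eq_zero.1 ((Submodule.isOrtho_iff_inner_eq.1 main.ortho) z h1 z h2)
  have hm' : ∀ x ∈ Vm, x ∈ Wm := by
    intro x hx
    obtain ⟨a, ha, b, hb, rfl⟩ := dec x ((memVm x).1 hx).2
    have : b ∈ Vm := by
      have h1 := Vm.toSubmodule.sub_mem hx (hm a ha)
      rwa [add_sub_cancel_left] at h1
    rw [disj b this (hp b hb), add_zero]
    exact ha
  have hp' : ∀ x ∈ Vp, x ∈ Wp := by
    intro x hx
    obtain ⟨a, ha, b, hb, rfl⟩ := dec x ((memVp x).1 hx).2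
    have : a ∈ Vp := by
      have h1 := Vp.toSubmodule.sub_mem hx (hp b hb)
      rwa [add_sub_cancel_right] at h1
    rw [disj a (hm a ha) this, zero_add]
    exact hb
  exact Prod.ext (SetLike.ext fun x => ⟨hm x, hm' x⟩) (SetLike.ext fun x => ⟨hp x, hp' x⟩)

/-- The negative eigenspace `V⁻(T)`: the first component of the spectral splitting of `T`
(which exists and is unique for self-adjoint `T`). -/
def negativeEigenspace {H : Type*} [NormedAddCommGroup H] [InnerProductSpace ℝ H]
    (T : H →L[ℝ] H) : ClosedSubmodule ℝ H :=
  Classical.epsilon fun Vm => ∃ Vp, IsSpectralSplitting T Vm Vp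

/-- For self-adjoint `T`, the subspace `V⁻(T)` is the negative part of the spectral splitting. -/
theorem negativeEigenspace_spec {H : Type*} [NormedAddCommGroup H] [InnerProductSpace ℝ H]
    [CompleteSpace H] {T : H →L[ℝ] H} (hT : IsSelfAdjoint T) :
    ∃ Vp, IsSpectralSplitting T (negativeEigenspace T) Vp := by
  obtain ⟨p, hp, _⟩ := existsUnique_isSpectralSplitting hT
  exact Classical.epsilon_spec
    (p := fun Vm => ∃ Vp, IsSpectralSplitting T Vm Vp) ⟨p.1, p.2, hp⟩

/-! ### Commensurable subspaces and relative dimension -/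

/-- Two closed subspaces are commensurable if the difference of the orthogonal projections onto
them is a compact operator. -/
def AreCommensurable {H : Type*} [NormedAddCommGroup H] [InnerProductSpace ℝ H] [CompleteSpace H]
    (V W : ClosedSubmodule ℝ H) : Prop :=
  IsCompactOperator (V.toSubmodule.starProjection - W.toSubmodule.starProjection)

/-- The relative dimension `dim (V, W) = dim (V ∩ Wᗮ) - dim (W ∩ Vᗮ)`. It is meaningful when both
intersections are finite dimensional, in particular for commensurable subspaces. -/
def relativeDim {H : Type*} [NormedAddCommGroup H] [InnerProductSpace ℝ H]
    (V W : ClosedSubmodule ℝ H) : ℤ :=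
  (Module.finrank ℝ ↥(V.toSubmodule ⊓ W.toSubmoduleᗮ) : ℤ) -
    (Module.finrank ℝ ↥(W.toSubmodule ⊓ V.toSubmoduleᗮ) : ℤ)

/-- A closed subspace of the closed subspace `V`, regarded as a closed subspace of `H`. (The
closure that is built into `ClosedSubmodule.map` changes nothing, by the lemma that follows.) -/
def includeSubspace {H : Type*} [NormedAddCommGroup H] [InnerProductSpace ℝ H]
    (V : ClosedSubmodule ℝ H) (W : ClosedSubmodule ℝ V.toSubmodule) : ClosedSubmodule ℝ H :=
  W.map V.toSubmodule.subtypeL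

theorem toSubmodule_includeSubspace {H : Type*} [NormedAddCommGroup H] [InnerProductSpace ℝ H]
    (V : ClosedSubmodule ℝ H) (W : ClosedSubmodule ℝ V.toSubmodule) :
    (includeSubspace V W).toSubmodule = W.toSubmodule.map V.toSubmodule.subtype := by
  refine IsClosed.submodule_topologicalClosure_eq ?_
  exact V.isClosed.isClosedEmbedding_subtypeVal.isClosedMap _ W.isClosed

end

/-!
Write `N = V⁻(T)`, `T' = P_V T|_V`, and `V = N' ⊕ P' ⊕ K` for the spectral splitting of `T'`, all
regarded as subspaces of `H`; `K` is the radical of `B|_V`, that is `V ∩ V^⊥B`. Since `T'` arises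
from `T` by composing with Fredholm operators, it is Fredholm, so both operators have closed range
and map the definite parts of their splittings bijectively onto themselves (`IsNegativePart`).

*Commensurability.* Let `S = P_V T P_V`, which differs from `T` by a compact operator and has
negative part `N'`. With `p`, `q` the projections to `N`, `N'`, the off-diagonal blocks
`X = (1 - p) q` and `X = p (1 - q)` satisfy `a X + X b = F` with `F` compact, where one of `a`, `b`
is positive and the other is positive and bounded below. Then
`X = (2 s)⁻¹ ((s - a) X + X (s - b) + F)` exhibits `X` as the fixed point of a contraction that
preserves the compact operators (`isCompactOperator_of_sylvester`), so `X` is compact, and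
`p - q = p (1 - q) - (1 - p) q`.

*The formula.* `B` is negative on `N'` and nonnegative on `Nᗮ`, so `N' ∩ Nᗮ = 0`, and `T` maps
`A = N ∩ N'^⊥B` isomorphically to `N ∩ N'ᗮ`; the relative dimension is therefore `dim A`. The form
is negative definite on `A` and nonnegative on the `B`-orthogonal complement of `A` in `N'^⊥B`
(`IsNegativePart.nonneg_of_orthogonal`). Let `M` be a maximal negative definite subspace of
`V^⊥B`. Then `M ⊕ K` is nonpositive and meets that complement only in `V ∩ ker T`, which gives
`dim M + dim K ≤ dim A + dim (V ∩ ker T)`. Conversely, the pairing of `A` with `K` vanishes on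
`V ∩ ker T`, and its kernel in `A` lies in `V^⊥B + P'`, where `B` has at most `dim M` negative
directions; this gives the opposite inequality.
-/

open scoped InnerProductSpace

/-! ### Definite subspaces of a symmetric form -/

section Form

variable {H : Type*} [NormedAddCommGroup H] [InnerProductSpace ℝ H] {B : H →L[ℝ] H →L[ℝ] ℝ}

theorem eq_zero_of_neg_of_nonneg {A C : Submodule ℝ H} (hA : ∀ x ∈ A, x ≠ 0 → B x x < 0)
    (hC : ∀ x ∈ C, 0 ≤ B x x) {x : H} (hxA : x ∈ A) (hxC : x ∈ C) : x = 0 := by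
  by_contra h
  exact (hA x hxA h).not_ge (hC x hxC)

/-- A form has at most `finrank M` negative directions on `M ⊔ C` if it is nonnegative on `C`. -/
theorem finrank_le_of_neg_of_nonneg {A M C : Submodule ℝ H} [FiniteDimensional ℝ M]
    (hA : ∀ x ∈ A, x ≠ 0 → B x x < 0) (hC : ∀ x ∈ C, 0 ≤ B x x) (hle : A ≤ M ⊔ C) :
    FiniteDimensional ℝ A ∧ Module.finrank ℝ A ≤ Module.finrank ℝ M := by
  have hmaps : ∀ x : A, C.mkQ x ∈ M.map C.mkQ := by
    rintro ⟨x, hx⟩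
    obtain ⟨m, hm, c, hc, rfl⟩ := Submodule.mem_sup.1 (hle hx)
    refine ⟨m, hm, ?_⟩
    have hc' : C.mkQ c = 0 := (Submodule.Quotient.mk_eq_zero C).2 hc
    rw [map_add, hc', add_zero]
  set f : A →ₗ[ℝ] M.map C.mkQ := (C.mkQ ∘ₗ A.subtype).codRestrict _ hmaps with hf
  have hinj : Function.Injective f := by
    rw [← LinearMap.ker_eq_bot, LinearMap.ker_eq_bot']
    intro x hx
    have hx' : C.mkQ (x : H) = 0 := congrArg Subtype.val hx
    exact Subtype.ext (eq_zero_of_neg_of_nonneg hA hC x.2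
      ((Submodule.Quotient.mk_eq_zero C).1 hx'))
  exact ⟨FiniteDimensional.of_injective f hinj,
    (LinearMap.finrank_le_finrank_of_injective hinj).trans (Submodule.finrank_map_le _ _)⟩

/-- The `B`-orthogonal projection to a finite dimensional negative definite subspace. -/
theorem exists_bilin_projection {M : Submodule ℝ H} [FiniteDimensional ℝ M]
    (hM : ∀ x ∈ M, x ≠ 0 → B x x < 0) (x : H) : ∃ m ∈ M, ∀ z ∈ M, B (x - m) z = 0 := by
  set f : M →ₗ[ℝ] Module.Dual ℝ M :=
    { toFun := fun m => (B m).toLinearMap ∘ₗ M.subtype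
      map_add' := fun _ _ => by ext; simp
      map_smul' := fun _ _ => by ext; simp } with hf
  have hinj : Function.Injective f := by
    rw [← LinearMap.ker_eq_bot, LinearMap.ker_eq_bot']
    intro m hm
    by_contra h
    have h1 : B m m = 0 := congrArg (fun g : Module.Dual ℝ M => g m) hm
    exact (hM m m.2 fun h' => h (Subtype.ext h')).ne h1
  obtain ⟨m, hm⟩ := (LinearMap.injective_iff_surjective_of_finrank_eq_finrank
    (Subspace.dual_finrank_eq (K := ℝ) (V := M)).symm).1 hinj ((B x).toLinearMap ∘ₗ M.subtype)
  refine ⟨m, m.2, fun z hz => ?_⟩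
  have h1 : B m z = B x z := congrArg (fun g : Module.Dual ℝ M => g ⟨z, hz⟩) hm
  simp [h1]

/-- On a finite dimensional subspace `L` a symmetric form splits into a negative definite and a
nonnegative part. -/
theorem exists_neg_sup_nonneg (hB : ∀ x y, B x y = B y x) (L : Submodule ℝ H)
    [FiniteDimensional ℝ L] : ∃ M C : Submodule ℝ H, M ⊔ C = L ∧
      (∀ x ∈ M, x ≠ 0 → B x x < 0) ∧ ∀ x ∈ C, 0 ≤ B x x := by
  set S : Set ℕ := {n | ∃ M : Submodule ℝ H, M ≤ L ∧ (∀ x ∈ M, x ≠ 0 → B x x < 0) ∧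
    Module.finrank ℝ M = n} with hS
  have hne : S.Nonempty := ⟨_, ⊥, bot_le, fun x hx h => (h ((Submodule.mem_bot ℝ).1 hx)).elim, rfl⟩
  have hbdd : BddAbove S := by
    refine ⟨Module.finrank ℝ L, ?_⟩
    rintro _ ⟨M, hM, -, rfl⟩
    exact Submodule.finrank_mono hM
  obtain ⟨M, hML, hM, hMn⟩ := Nat.sSup_mem hne hbdd
  have : FiniteDimensional ℝ M := Submodule.finiteDimensional_of_le hML
  refine ⟨M, L ⊓ bilinOrthogonal B M, le_antisymm (sup_le hML inf_le_left) ?_, hM, ?_⟩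
  · intro x hx
    obtain ⟨m, hm, hz⟩ := exists_bilin_projection hM x
    exact Submodule.mem_sup.2 ⟨m, hm, x - m, ⟨L.sub_mem hx (hML hm), hz⟩, by abel⟩
  · rintro x ⟨hxL, hx⟩
    by_contra! hneg
    have hlt : M < M ⊔ Submodule.span ℝ {x} := by
      refine left_lt_sup.2 fun h => ?_
      exact hneg.ne (hx x (h (Submodule.mem_span_singleton_self x)))
    have hle : M ⊔ Submodule.span ℝ {x} ≤ L :=
      sup_le hML ((Submodule.span_singleton_le_iff_mem _ _).2 hxL)
    have : FiniteDimensional ℝ ↥(M ⊔ Submodule.span ℝ {x}) :=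
      Submodule.finiteDimensional_of_le hle
    refine (Submodule.finrank_lt_finrank_of_lt hlt).not_ge ?_
    rw [hMn]
    refine le_csSup hbdd ⟨_, hle, fun y hy hy0 => ?_, rfl⟩
    obtain ⟨m, hm, w, hw, rfl⟩ := Submodule.mem_sup.1 hy
    obtain ⟨c, rfl⟩ := Submodule.mem_span_singleton.1 hw
    have e : B (m + c • x) (m + c • x) = B m m + c ^ 2 * B x x := by
      have h1 := hx m hm
      have h2 := hB m x
      simp only [map_add, map_smul, add_apply, smul_apply, smul_eq_mul, h1, h2]
      ring
    rw [e]
    rcases eq_or_ne m 0 with rfl | hm0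
    · have hc : c ≠ 0 := by rintro rfl; simp at hy0
      have : 0 < c ^ 2 := by positivity
      simp only [map_zero, zero_add]
      nlinarith
    · nlinarith [hM m hm hm0, sq_nonneg c]

theorem morseIndex_restrictForm {L M C : Submodule ℝ H} [FiniteDimensional ℝ M]
    (hL : M ⊔ C = L) (hM : ∀ x ∈ M, x ≠ 0 → B x x < 0) (hC : ∀ x ∈ C, 0 ≤ B x x) :
    morseIndex (restrictForm B L) = Module.finrank ℝ M := by
  refine le_antisymm (iSup_le ?_) ?_
  · rintro ⟨W, hW⟩
    obtain ⟨hfin, hle⟩ := finrank_le_of_neg_of_nonneg (B := B) (A := W.map L.subtype) (M := M)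
      (C := C) (by
        rintro _ ⟨x, hx, rfl⟩ h0
        exact hW x hx fun h => h0 (by simp [h])) hC (hL ▸ Submodule.map_subtype_le L W)
    have e := Submodule.equivMapOfInjective L.subtype L.subtype_injective W
    have : FiniteDimensional ℝ W := Module.Finite.equiv e.symm
    rw [← e.finrank_eq] at hle
    change Cardinal.toENat (Module.rank ℝ W) ≤ _
    rw [← Module.finrank_eq_rank, Cardinal.toENat_nat]
    exact_mod_cast hle
  · have hML : M ≤ L := hL ▸ le_sup_left
    have e := Submodule.comapSubtypeEquivOfLe hML
    have : FiniteDimensional ℝ ↥(Submodule.comap L.subtype M) := Module.Finite.equiv e.symm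
    have hrank : Cardinal.toENat (Module.rank ℝ ↥(Submodule.comap L.subtype M)) =
        Module.finrank ℝ M := by
      rw [← Module.finrank_eq_rank, Cardinal.toENat_nat, e.finrank_eq]
    rw [← hrank]
    exact le_iSup (fun W : {W : Submodule ℝ L // ∀ x ∈ W, x ≠ 0 → restrictForm B L x x < 0} =>
      Cardinal.toENat (Module.rank ℝ W.1)) ⟨Submodule.comap L.subtype M, fun x hx h0 =>
        hM x hx fun h => h0 (Subtype.ext h)⟩

/-- An isotropic vector of a form that is nonnegative on `C` lies in the radical of the form on
`C`. -/
theorem apply_eq_zero_of_nonneg (hB : ∀ x y, B x y = B y x) {C : Submodule ℝ H}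
    (hC : ∀ x ∈ C, 0 ≤ B x x) {x y : H} (hx : x ∈ C) (hy : y ∈ C) (h0 : B x x = 0) :
    B x y = 0 := by
  have key : ∀ t : ℝ, 0 ≤ 2 * t * B x y + B y y := fun t => by
    have h1 := hC _ (C.add_mem (C.smul_mem t hx) hy)
    have h2 := hB y x
    simp only [map_add, map_smul, add_apply, smul_apply, smul_eq_mul, h0, h2] at h1
    linarith
  by_contra h
  have h1 := key (-(B y y + 1) / (2 * B x y))
  have h2 : 2 * (-(B y y + 1) / (2 * B x y)) * B x y = -(B y y + 1) := by field_simp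
  linarith

end Form

/-! ### Compactness from a Sylvester equation -/

section Sylvester

variable {H : Type*} [NormedAddCommGroup H] [InnerProductSpace ℝ H]

theorem norm_apply_sq_le_of_nonneg {b : H →L[ℝ] H} (hb : ∀ x y, ⟪b x, y⟫_ℝ = ⟪x, b y⟫_ℝ)
    (hpos : ∀ x, 0 ≤ ⟪b x, x⟫_ℝ) (x : H) : ‖b x‖ ^ 2 ≤ ‖b‖ * ⟪b x, x⟫_ℝ := by
  have h1 := LinearMap.BilinForm.apply_mul_apply_le_of_forall_zero_le
    ((innerₗ H).comp b.toLinearMap) (fun x => by simpa using hpos x) x (b x)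
  have e : ⟪b (b x), x⟫_ℝ = ‖b x‖ ^ 2 := by rw [hb, real_inner_self_eq_norm_sq]
  simp only [LinearMap.comp_apply, ContinuousLinearMap.coe_coe, innerₗ_apply_apply,
    real_inner_self_eq_norm_sq, e] at h1
  have h2 : ⟪b (b x), b x⟫_ℝ ≤ ‖b‖ * ‖b x‖ ^ 2 := by
    refine (real_inner_le_norm _ _).trans ?_
    have := mul_le_mul_of_nonneg_right (b.le_opNorm (b x)) (norm_nonneg (b x))
    linarith
  rcases eq_or_lt_of_le (sq_nonneg ‖b x‖) with h0 | h0
  · rw [← h0]; exact mul_nonneg (norm_nonneg _) (hpos x)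
  · have h3 := mul_le_mul_of_nonneg_left h2 (hpos x)
    exact le_of_mul_le_mul_right (by linarith) h0

/-- If `b` is positive and bounded below by `m`, then `s - b` has norm at most `√(s² - m²)` for
`s ≥ ‖b‖`. -/
theorem norm_smul_one_sub_le {b : H →L[ℝ] H} (hb : ∀ x y, ⟪b x, y⟫_ℝ = ⟪x, b y⟫_ℝ)
    (hpos : ∀ x, 0 ≤ ⟪b x, x⟫_ℝ) {s m : ℝ} (hs : ‖b‖ ≤ s) (hm : 0 ≤ m)
    (hbelow : ∀ x, m * ‖x‖ ≤ ‖b x‖) : ‖s • (1 : H →L[ℝ] H) - b‖ ≤ √(s ^ 2 - m ^ 2) := by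
  refine ContinuousLinearMap.opNorm_le_bound _ (Real.sqrt_nonneg _) fun x => ?_
  have h1 : ‖(s • (1 : H →L[ℝ] H) - b) x‖ ^ 2 ≤ (s ^ 2 - m ^ 2) * ‖x‖ ^ 2 := by
    have e : (s • (1 : H →L[ℝ] H) - b) x = s • x - b x := by simp
    rw [e, norm_sub_sq_real, inner_smul_left, norm_smul, mul_pow, real_inner_comm]
    have h2 := norm_apply_sq_le_of_nonneg hb hpos x
    have h3 := mul_le_mul_of_nonneg_right hs (hpos x)
    have h4 := pow_le_pow_left₀ (by positivity) (hbelow x) 2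
    simp only [Real.norm_eq_abs, sq_abs, conj_trivial]
    nlinarith
  rw [← Real.sqrt_sq (norm_nonneg ((s • (1 : H →L[ℝ] H) - b) x)),
    ← Real.sqrt_sq (norm_nonneg x), ← Real.sqrt_mul' _ (sq_nonneg _)]
  exact Real.sqrt_le_sqrt h1

/-- A solution `X` of the Sylvester equation `a X + X b = F` is compact if `F` is compact and
`a`, `b` are close to a common positive multiple of the identity. For positive `a`, `b`, one of
which is bounded below, this holds for every large `s`. -/
theorem isCompactOperator_of_sylvester [CompleteSpace H] {a b X : H →L[ℝ] H} {s : ℝ} (hs : 0 < s)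
    (hab : ‖s • (1 : H →L[ℝ] H) - a‖ + ‖s • (1 : H →L[ℝ] H) - b‖ < 2 * s)
    (hF : IsCompactOperator (a * X + X * b)) : IsCompactOperator X := by
  set F := a * X + X * b
  set a' := s • (1 : H →L[ℝ] H) - a with ha'
  set b' := s • (1 : H →L[ℝ] H) - b with hb'
  set r := (2 * s)⁻¹ * (‖a'‖ + ‖b'‖) with hr
  have hr0 : 0 ≤ r := by positivity
  have hr1 : r < 1 := by
    rw [hr, inv_mul_lt_one₀ (by positivity)]; exact hab
  -- `X` is the fixed point of the affine contraction that is iterated here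
  let K : ℕ → (H →L[ℝ] H) := fun n =>
    Nat.rec 0 (fun _ Y => (2 * s)⁻¹ • (a' * Y + Y * b' + F)) n
  have hK : ∀ n, K (n + 1) = (2 * s)⁻¹ • (a' * K n + K n * b' + F) := fun _ => rfl
  have hcpt : ∀ n, IsCompactOperator (K n) := by
    intro n
    induction n with
    | zero => exact isCompactOperator_zero
    | succ n ih =>
      rw [hK]
      exact (((ih.clm_comp a').add (ih.comp_clm b')).add hF).smul (2 * s)⁻¹
  have hfix : X = (2 * s)⁻¹ • (a' * X + X * b' + F) := by
    have : a' * X + X * b' + F = (2 * s) • X := by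
      simp only [ha', hb', F, sub_mul, mul_sub, smul_mul_assoc, mul_smul_comm, one_mul, mul_one,
        two_mul, add_smul]
      abel
    rw [this, smul_smul, inv_mul_cancel₀ (by positivity), one_smul]
  have hdist : ∀ n, ‖K n - X‖ ≤ r ^ n * ‖X‖ := by
    intro n
    induction n with
    | zero =>
      have : K 0 = 0 := rfl
      simp [this]
    | succ n ih =>
      have e : K (n + 1) - X = (2 * s)⁻¹ • (a' * (K n - X) + (K n - X) * b') := by
        rw [hK]
        conv_lhs => rw [hfix]
        rw [← smul_sub]
        congr 1
        noncomm_ring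
      rw [e, norm_smul, Real.norm_of_nonneg (by positivity)]
      have h1 : ‖a' * (K n - X) + (K n - X) * b'‖ ≤ (‖a'‖ + ‖b'‖) * ‖K n - X‖ := by
        refine (norm_add_le _ _).trans ?_
        have := norm_mul_le a' (K n - X)
        have := norm_mul_le (K n - X) b'
        linarith
      calc (2 * s)⁻¹ * ‖a' * (K n - X) + (K n - X) * b'‖
          ≤ (2 * s)⁻¹ * ((‖a'‖ + ‖b'‖) * ‖K n - X‖) := by gcongr
        _ = r * ‖K n - X‖ := by rw [hr, mul_assoc]
        _ ≤ r * (r ^ n * ‖X‖) := by gcongr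
        _ = r ^ (n + 1) * ‖X‖ := by ring
  have hlim : Filter.Tendsto K Filter.atTop (nhds X) := by
    rw [tendsto_iff_norm_sub_tendsto_zero]
    refine squeeze_zero (fun _ => norm_nonneg _) hdist ?_
    simpa using (tendsto_pow_atTop_nhds_zero_of_lt_one hr0 hr1).mul_const ‖X‖
  exact isCompactOperator_of_tendsto hlim (Filter.Eventually.of_forall hcpt)

end Sylvester

/-! ### Negative parts of self-adjoint operators -/

section NegativePart

variable {H : Type*} [NormedAddCommGroup H] [InnerProductSpace ℝ H]

/-- `N` is a `T`-invariant subspace on which `T` is bijective and negative definite, and `T` is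
nonnegative on the orthogonal complement. For a self-adjoint Fredholm operator this describes the
negative eigenspace. -/
structure IsNegativePart (T : H →L[ℝ] H) (N : ClosedSubmodule ℝ H) : Prop where
  map_mem : ∀ x ∈ N, T x ∈ N
  surj : ∀ x ∈ N, ∃ y ∈ N, T y = x
  neg_def : ∀ x ∈ N, x ≠ 0 → ⟪T x, x⟫_ℝ < 0
  nonneg : ∀ x ∈ N.toSubmoduleᗮ, 0 ≤ ⟪T x, x⟫_ℝ

variable [CompleteSpace H]

theorem IsNegativePart.exists_bound {T : H →L[ℝ] H} {N : ClosedSubmodule ℝ H}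
    (h : IsNegativePart T N) : ∃ m : ℝ, 0 < m ∧ ∀ x ∈ N, m * ‖x‖ ≤ ‖T x‖ := by
  set f : N.toSubmodule →L[ℝ] N.toSubmodule :=
    (T ∘L N.toSubmodule.subtypeL).codRestrict N.toSubmodule fun x => h.map_mem x x.2 with hf
  have hinj : f.ker = ⊥ := by
    rw [LinearMap.ker_eq_bot']
    intro x hx
    by_contra h0
    have h1 : T x = 0 := congrArg Subtype.val hx
    have h2 := h.neg_def x x.2 fun h' => h0 (Subtype.ext h')
    rw [h1, inner_zero_left] at h2
    exact h2.false
  have hsurj : f.range = ⊤ := by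
    rw [LinearMap.range_eq_top]
    intro x
    obtain ⟨y, hy, hyx⟩ := h.surj x x.2
    exact ⟨⟨y, hy⟩, Subtype.ext hyx⟩
  set e := ContinuousLinearEquiv.ofBijective f hinj hsurj with he
  refine ⟨(‖(e.symm : N.toSubmodule →L[ℝ] N.toSubmodule)‖ + 1)⁻¹, by positivity, fun x hx => ?_⟩
  rw [inv_mul_le_iff₀ (by positivity)]
  have h1 : e.symm (f ⟨x, hx⟩) = ⟨x, hx⟩ := by
    rw [e.symm_apply_eq]; rfl
  have h2 := (e.symm : N.toSubmodule →L[ℝ] N.toSubmodule).le_opNorm (f ⟨x, hx⟩)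
  rw [ContinuousLinearEquiv.coe_coe, h1] at h2
  have h3 : ‖f ⟨x, hx⟩‖ = ‖T x‖ := rfl
  have h4 : ‖(⟨x, hx⟩ : N.toSubmodule)‖ = ‖x‖ := rfl
  rw [h3, h4] at h2
  nlinarith [norm_nonneg (T x)]

theorem IsNegativePart.commute {T : H →L[ℝ] H} {N : ClosedSubmodule ℝ H}
    (hT : ∀ x y, ⟪T x, y⟫_ℝ = ⟪x, T y⟫_ℝ) (h : IsNegativePart T N) :
    Commute T N.toSubmodule.starProjection := by
  ext x
  change T (N.toSubmodule.starProjection x) = N.toSubmodule.starProjection (T x)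
  refine (Submodule.eq_starProjection_of_mem_orthogonal
    (h.map_mem _ (Submodule.starProjection_apply_mem _ x)) ?_).symm
  rw [← map_sub, Submodule.mem_orthogonal']
  intro u hu
  rw [hT]
  exact (Submodule.mem_orthogonal' _ _).1 (N.toSubmodule.sub_starProjection_mem_orthogonal x) _
    (h.map_mem u hu)

/-- The compression of `T` to the orthogonal complement of its negative part is positive. -/
theorem IsNegativePart.norm_sub_compl_le {T : H →L[ℝ] H} {N : ClosedSubmodule ℝ H}
    (hT : ∀ x y, ⟪T x, y⟫_ℝ = ⟪x, T y⟫_ℝ) (h : IsNegativePart T N) :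
    ∃ s₀ : ℝ, ∀ s, s₀ ≤ s → ‖s • (1 : H →L[ℝ] H) - (1 - N.toSubmodule.starProjection) * T *
      (1 - N.toSubmodule.starProjection)‖ ≤ s := by
  set p := N.toSubmodule.starProjection with hp
  have hps : ∀ x y, ⟪(1 - p) x, y⟫_ℝ = ⟪x, (1 - p) y⟫_ℝ := fun x y => by
    simp only [sub_apply, one_apply_eq_self, inner_sub_left, inner_sub_right, hp,
      Submodule.inner_starProjection_left_eq_right]
  refine ⟨‖(1 - p) * T * (1 - p)‖, fun s hs => ?_⟩
  have hs0 : 0 ≤ s := (norm_nonneg _).trans hs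
  have h1 := norm_smul_one_sub_le (b := (1 - p) * T * (1 - p)) (s := s) (m := 0)
    (fun x y => by
      change ⟪(1 - p) (T ((1 - p) x)), y⟫_ℝ = ⟪x, (1 - p) (T ((1 - p) y))⟫_ℝ
      rw [hps, hT, hps])
    (fun x => by
      change 0 ≤ ⟪(1 - p) (T ((1 - p) x)), x⟫_ℝ
      rw [hps]
      exact h.nonneg _ (N.toSubmodule.sub_starProjection_mem_orthogonal x)) hs le_rfl
    (fun x => by simp)
  simpa [Real.sqrt_sq hs0] using h1

/-- The operator that is `-T` on the negative part and the identity on its orthogonal complement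
is positive and bounded below. -/
theorem IsNegativePart.norm_sub_lt {T : H →L[ℝ] H} {N : ClosedSubmodule ℝ H}
    (hT : ∀ x y, ⟪T x, y⟫_ℝ = ⟪x, T y⟫_ℝ) (h : IsNegativePart T N) :
    ∃ s₀ : ℝ, ∀ s, s₀ ≤ s → 0 < s → ‖s • (1 : H →L[ℝ] H) - ((1 - N.toSubmodule.starProjection) -
      N.toSubmodule.starProjection * T * N.toSubmodule.starProjection)‖ < s := by
  obtain ⟨m, hm, hbound⟩ := h.exists_bound
  set p := N.toSubmodule.starProjection with hp
  set b := (1 - p) - p * T * p with hb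
  have hps : ∀ x y, ⟪p x, y⟫_ℝ = ⟪x, p y⟫_ℝ :=
    fun x y => Submodule.inner_starProjection_left_eq_right _ _ _
  have hpN : ∀ x, p x ∈ N := fun x => Submodule.starProjection_apply_mem _ x
  have hfix : ∀ x ∈ N, p x = x := fun x hx => Submodule.starProjection_eq_self_iff.2 hx
  have hbx : ∀ x, b x = (x - p x) - T (p x) := fun x => by
    change (x - p x) - p (T (p x)) = _
    rw [hfix _ (h.map_mem _ (hpN x))]
  have horth : ∀ x, ∀ u ∈ N, ⟪x - p x, u⟫_ℝ = 0 := fun x u hu =>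
    (Submodule.mem_orthogonal' _ _).1 (N.toSubmodule.sub_starProjection_mem_orthogonal x) u hu
  set c := min m 1 with hc
  have hc0 : 0 < c := lt_min hm one_pos
  have hbelow : ∀ x, c * ‖x‖ ≤ ‖b x‖ := by
    intro x
    refine le_of_sq_le_sq ?_ (norm_nonneg _)
    have e1 : ‖b x‖ ^ 2 = ‖x - p x‖ ^ 2 + ‖T (p x)‖ ^ 2 := by
      rw [hbx, norm_sub_sq_real, horth x _ (h.map_mem _ (hpN x))]; ring
    have e2 : ‖x‖ ^ 2 = ‖x - p x‖ ^ 2 + ‖p x‖ ^ 2 := by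
      conv_lhs => rw [← sub_add_cancel x (p x)]
      rw [norm_add_sq_real, horth x _ (hpN x)]; ring
    have h1 : c * ‖p x‖ ≤ ‖T (p x)‖ :=
      (mul_le_mul_of_nonneg_right (min_le_left _ _) (norm_nonneg _)).trans (hbound _ (hpN x))
    have h2 := pow_le_pow_left₀ (by positivity) h1 2
    have h3 : c ^ 2 ≤ 1 := pow_le_one₀ hc0.le (min_le_right _ _)
    rw [mul_pow, e1, e2]
    nlinarith [sq_nonneg ‖x - p x‖]
  refine ⟨‖b‖, fun s hs hs0 => ?_⟩
  refine (norm_smul_one_sub_le (fun x y => ?_) (fun x => ?_) hs hc0.le hbelow).trans_lt ?_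
  · change ⟪x - p x - p (T (p x)), y⟫_ℝ = ⟪x, y - p y - p (T (p y))⟫_ℝ
    simp only [inner_sub_left, inner_sub_right, hps, hT]
  · rw [hbx, inner_sub_left]
    have e1 : ⟪x - p x, x⟫_ℝ = ‖x - p x‖ ^ 2 := by
      rw [← real_inner_self_eq_norm_sq, inner_sub_right (x - p x), horth x _ (hpN x), sub_zero]
    have e2 : ⟪T (p x), x⟫_ℝ = ⟪T (p x), p x⟫_ℝ := by
      conv_lhs => rw [← hfix _ (h.map_mem _ (hpN x)), hps]
    have h3 : ⟪T (p x), p x⟫_ℝ ≤ 0 := by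
      rcases eq_or_ne (p x) 0 with h0 | h0
      · simp [h0]
      · exact (h.neg_def _ (hpN x) h0).le
    rw [e1, e2]
    nlinarith [sq_nonneg ‖x - p x‖]
  · rw [Real.sqrt_lt' hs0]
    nlinarith [sq_pos_of_pos hc0]

/-- Self-adjoint operators that differ by a compact operator have commensurable negative parts:
the off-diagonal blocks of the two projections solve Sylvester equations with compact right-hand
side. -/
theorem IsNegativePart.areCommensurable {T S : H →L[ℝ] H} {N M : ClosedSubmodule ℝ H}
    (hT : ∀ x y, ⟪T x, y⟫_ℝ = ⟪x, T y⟫_ℝ) (hS : ∀ x y, ⟪S x, y⟫_ℝ = ⟪x, S y⟫_ℝ)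
    (hN : IsNegativePart T N) (hM : IsNegativePart S M) (hTS : IsCompactOperator (T - S)) :
    AreCommensurable N M := by
  obtain ⟨s₁, h₁⟩ := hN.norm_sub_compl_le hT
  obtain ⟨s₂, h₂⟩ := hN.norm_sub_lt hT
  obtain ⟨s₃, h₃⟩ := hM.norm_sub_compl_le hS
  obtain ⟨s₄, h₄⟩ := hM.norm_sub_lt hS
  have hTp := (hN.commute hT).eq
  have hSq := (hM.commute hS).eq
  unfold AreCommensurable
  have hpp : N.toSubmodule.starProjection * N.toSubmodule.starProjection =
    N.toSubmodule.starProjection := N.toSubmodule.isIdempotentElem_starProjection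
  have hqq : M.toSubmodule.starProjection * M.toSubmodule.starProjection =
    M.toSubmodule.starProjection := M.toSubmodule.isIdempotentElem_starProjection
  set p := N.toSubmodule.starProjection
  set q := M.toSubmodule.starProjection
  set s := max 1 (max (max s₁ s₂) (max s₃ s₄)) with hs
  have hs0 : 0 < s := lt_of_lt_of_le one_pos (le_max_left _ _)
  have k₁ := h₁ s (by simp [hs])
  have k₂ := h₂ s (by simp [hs]) hs0
  have k₃ := h₃ s (by simp [hs])
  have k₄ := h₄ s (by simp [hs]) hs0
  have hpp' : p * (1 - p) = 0 := by rw [mul_sub, hpp, mul_one, sub_self]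
  have hqq' : q * (1 - q) = 0 := by rw [mul_sub, hqq, mul_one, sub_self]
  have hp'p : (1 - p) * p = 0 := by rw [sub_mul, hpp, one_mul, sub_self]
  have hp'p' : (1 - p) * (1 - p) = 1 - p := by rw [mul_sub, hp'p, mul_one, sub_zero]
  have hq'q' : (1 - q) * (1 - q) = 1 - q := by rw [sub_mul, hqq', one_mul, sub_zero]
  have hTp' : T * (1 - p) = (1 - p) * T := by rw [mul_sub, sub_mul, hTp, mul_one, one_mul]
  have hSq' : S * (1 - q) = (1 - q) * S := by rw [mul_sub, sub_mul, hSq, mul_one, one_mul]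
  have c₁ : IsCompactOperator ((1 - p) * q : H →L[ℝ] H) := by
    refine isCompactOperator_of_sylvester hs0 (by linarith) (a := (1 - p) * T * (1 - p))
      (b := (1 - q) - q * S * q) ?_
    have e : (1 - p) * T * (1 - p) * ((1 - p) * q) + (1 - p) * q * ((1 - q) - q * S * q) =
        (1 - p) * (T - S) * q := by
      have e1 : (1 - p) * T * (1 - p) * ((1 - p) * q) = (1 - p) * T * q := by
        rw [← mul_assoc, mul_assoc ((1 - p) * T), hp'p', mul_assoc (1 - p), hTp', ← mul_assoc,
          hp'p']
      have e2 : (1 - p) * q * ((1 - q) - q * S * q) = -((1 - p) * S * q) := by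
        rw [mul_sub, mul_assoc, hqq', mul_zero, zero_sub, mul_assoc q, hSq, ← mul_assoc q, hqq,
          mul_assoc, ← mul_assoc q, hqq, ← hSq, ← mul_assoc]
      rw [e1, e2]; noncomm_ring
    rw [e]
    exact (hTS.clm_comp (1 - p)).comp_clm q
  have c₂ : IsCompactOperator (p * (1 - q) : H →L[ℝ] H) := by
    refine isCompactOperator_of_sylvester hs0 (by linarith) (a := (1 - p) - p * T * p)
      (b := (1 - q) * S * (1 - q)) ?_
    have e : ((1 - p) - p * T * p) * (p * (1 - q)) + p * (1 - q) * ((1 - q) * S * (1 - q)) =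
        -(p * (T - S) * (1 - q)) := by
      have e1 : ((1 - p) - p * T * p) * (p * (1 - q)) = -(p * T * (1 - q)) := by
        rw [← mul_assoc, sub_mul, hp'p, zero_sub, mul_assoc (p * T), hpp, mul_assoc p, hTp,
          ← mul_assoc p, hpp, neg_mul]
      have e2 : p * (1 - q) * ((1 - q) * S * (1 - q)) = p * S * (1 - q) := by
        rw [mul_assoc (1 - q), hSq', ← mul_assoc (1 - q), hq'q', mul_assoc, ← mul_assoc (1 - q),
          hq'q', ← hSq', ← mul_assoc]
      rw [e1, e2]; noncomm_ring
    rw [e]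
    exact ((hTS.clm_comp p).comp_clm (1 - q)).neg
  have e : p - q = p * (1 - q) - (1 - p) * q := by noncomm_ring
  rw [e]
  exact c₂.sub c₁

end NegativePart

/-! ### Counting negative directions -/

section Count

variable {H : Type*} [NormedAddCommGroup H] [InnerProductSpace ℝ H] {B : H →L[ℝ] H →L[ℝ] ℝ}

/-- Let `V = N' ⊔ P' ⊔ K` be a `B`-orthogonal splitting whose summands are negative definite,
nonnegative and the radical of `B|_V`, and let `A` be a negative definite subspace that is
`B`-orthogonal to `N'`. The pairing of `A` with `K` has rank at most `dim K - dim R`, as `R` lies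
in the radical of `B`, and its kernel in `A` lies in `V^⊥B + P'`, where `B` has at most `dim M`
negative directions. -/
theorem finrank_add_finrank_le_of_neg (hB : ∀ x y, B x y = B y x)
    {V N' P' K A R M C : Submodule ℝ H} (hV : N' ⊔ P' ⊔ K = V)
    (hNP : ∀ x ∈ P', ∀ y ∈ N', B x y = 0) (hP : ∀ x ∈ P', 0 ≤ B x x)
    (hPproj : ∀ x, ∃ p ∈ P', ∀ z ∈ P', B (x - p) z = 0)
    (hK : K = V ⊓ bilinOrthogonal B V) [FiniteDimensional ℝ K] (hRK : R ≤ K)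
    (hR : ∀ x ∈ R, ∀ y, B x y = 0) [FiniteDimensional ℝ M]
    (hMC : M ⊔ C = bilinOrthogonal B V) (hC : ∀ x ∈ C, 0 ≤ B x x)
    [FiniteDimensional ℝ A] (hA : ∀ x ∈ A, x ≠ 0 → B x x < 0)
    (hAN : A ≤ bilinOrthogonal B N') :
    Module.finrank ℝ A + Module.finrank ℝ R ≤ Module.finrank ℝ M + Module.finrank ℝ K := by
  have hPV : P' ≤ V := hV ▸ le_sup_right.trans le_sup_left
  have hCL : C ≤ bilinOrthogonal B V := hMC ▸ le_sup_right
  set f : A →ₗ[ℝ] Module.Dual ℝ K :=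
    { toFun := fun a => (B a).toLinearMap ∘ₗ K.subtype
      map_add' := fun _ _ => by ext; simp
      map_smul' := fun _ _ => by ext; simp } with hf
  have hfa : ∀ (a : A) (k : K), f a k = B a k := fun _ _ => rfl
  have hCP : ∀ x ∈ C ⊔ P', 0 ≤ B x x := by
    intro x hx
    obtain ⟨c, hc, p, hp, rfl⟩ := Submodule.mem_sup.1 hx
    have h1 : B c p = 0 := hCL hc p (hPV hp)
    have h2 : B p c = 0 := by rw [hB, h1]
    simp only [map_add, add_apply, h1, h2]
    linarith [hC c hc, hP p hp]
  have hker : Module.finrank ℝ f.ker ≤ Module.finrank ℝ M := by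
    rw [← Submodule.finrank_map_subtype_eq]
    refine (finrank_le_of_neg_of_nonneg (B := B) (M := M) (C := C ⊔ P') ?_ hCP ?_).2
    · rintro _ ⟨a, -, rfl⟩
      exact hA a a.2
    · rintro _ ⟨a, ha, rfl⟩
      obtain ⟨p, hp, hpz⟩ := hPproj a
      have hmem : (a : H) - p ∈ bilinOrthogonal B V := by
        intro y hy
        rw [← hV] at hy
        obtain ⟨w, hw, k, hk, rfl⟩ := Submodule.mem_sup.1 hy
        obtain ⟨n, hn, z, hz, rfl⟩ := Submodule.mem_sup.1 hw
        have e1 : B (a - p : H) n = 0 := by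
          rw [map_sub, sub_apply, hAN a.2 n hn, hNP p hp n hn, sub_zero]
        have e2 : B (a : H) k = 0 := congrArg (fun g : Module.Dual ℝ K => g ⟨k, hk⟩) ha
        have e3 : B p k = 0 := by
          rw [hB]
          rw [hK] at hk
          exact hk.2 p (hPV hp)
        have e4 : B (a - p : H) k = 0 := by rw [map_sub, sub_apply, e2, e3, sub_zero]
        rw [map_add, map_add, e1, hpz z hz, e4, add_zero, add_zero]
      rw [← sup_assoc, hMC]
      exact Submodule.mem_sup.2 ⟨_, hmem, p, hp, sub_add_cancel _ _⟩
  have hrange : Module.finrank ℝ f.range + Module.finrank ℝ R ≤ Module.finrank ℝ K := by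
    have h1 := Subspace.finrank_add_finrank_dualAnnihilator_eq (R.comap K.subtype)
    rw [(Submodule.comapSubtypeEquivOfLe hRK).finrank_eq] at h1
    have h2 : f.range ≤ (R.comap K.subtype).dualAnnihilator := by
      rintro _ ⟨a, rfl⟩
      rw [Submodule.mem_dualAnnihilator]
      intro k hk
      rw [hfa, hB]
      exact hR _ hk _
    have h3 := Submodule.finrank_mono h2
    omega
  have h := f.finrank_range_add_finrank_ker
  omega

theorem finrank_le_add_of_inf_le {A C Z R : Submodule ℝ H} [FiniteDimensional ℝ A]
    [FiniteDimensional ℝ R] [FiniteDimensional ℝ Z] (hZ : Z ≤ A ⊔ C) (hR : Z ⊓ C ≤ R) :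
    Module.finrank ℝ Z ≤ Module.finrank ℝ A + Module.finrank ℝ R := by
  have h := (C.mkQ ∘ₗ Z.subtype).finrank_range_add_finrank_ker
  have h1 : Module.finrank ℝ (C.mkQ ∘ₗ Z.subtype).range ≤ Module.finrank ℝ A := by
    refine (Submodule.finrank_mono (t := A.map C.mkQ) ?_).trans (Submodule.finrank_map_le _ _)
    rintro _ ⟨x, rfl⟩
    obtain ⟨a, ha, c, hc, hx⟩ := Submodule.mem_sup.1 (hZ x.2)
    refine ⟨a, ha, ?_⟩
    have hc' : C.mkQ c = 0 := (Submodule.Quotient.mk_eq_zero C).2 hc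
    change _ = C.mkQ (x : H)
    rw [← hx, map_add, hc', add_zero]
  have h2 : Module.finrank ℝ (C.mkQ ∘ₗ Z.subtype).ker ≤ Module.finrank ℝ R := by
    rw [← Submodule.finrank_map_subtype_eq]
    refine Submodule.finrank_mono ?_
    rintro _ ⟨x, hx, rfl⟩
    exact hR ⟨x.2, (Submodule.Quotient.mk_eq_zero C).1 hx⟩
  omega

/-- The converse estimate: the sum of a negative definite part of `V^⊥B` and the radical of `B|_V`
is a nonpositive subspace, and it meets a nonnegative complement of `A` only in the radical of
`B`. -/
theorem finrank_add_finrank_le_of_nonneg_compl (hB : ∀ x y, B x y = B y x)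
    {V N' K A R M C : Submodule ℝ H} (hN'V : N' ≤ V)
    (hNproj : ∀ x, ∃ n ∈ N', ∀ z ∈ N', B (x - n) z = 0)
    (hK : K = V ⊓ bilinOrthogonal B V) [FiniteDimensional ℝ K]
    [FiniteDimensional ℝ R] (hR : ∀ x ∈ V, (∀ y, B x y = 0) → x ∈ R)
    [FiniteDimensional ℝ M] (hML : M ≤ bilinOrthogonal B V) (hM : ∀ x ∈ M, x ≠ 0 → B x x < 0)
    [FiniteDimensional ℝ A] (hAC : A ⊔ C = bilinOrthogonal B N')
    (hCA : C ≤ bilinOrthogonal B A) (hC : ∀ x ∈ C, 0 ≤ B x x) :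
    Module.finrank ℝ M + Module.finrank ℝ K ≤ Module.finrank ℝ A + Module.finrank ℝ R := by
  have hKV : K ≤ V := hK ▸ inf_le_left
  have hKL : K ≤ bilinOrthogonal B V := hK ▸ inf_le_right
  have hLQ : bilinOrthogonal B V ≤ bilinOrthogonal B N' := fun x hx y hy => hx y (hN'V hy)
  have hKK : ∀ x ∈ K, B x x = 0 := fun x hx => hKL hx x (hKV hx)
  have hdisj : M ⊓ K = ⊥ := by
    rw [eq_bot_iff]
    rintro x ⟨hxM, hxK⟩
    exact eq_zero_of_neg_of_nonneg hM (fun x hx => (hKK x hx).ge) hxM hxK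
  have hdim := Submodule.finrank_sup_add_finrank_inf_eq M K
  rw [hdisj, finrank_bot, add_zero] at hdim
  rw [← hdim]
  refine finrank_le_add_of_inf_le (C := C) (hAC ▸ (sup_le hML hKL).trans hLQ) ?_
  rintro x ⟨hxZ, hxC⟩
  obtain ⟨m, hm, k, hk, rfl⟩ := Submodule.mem_sup.1 hxZ
  have h1 : B m k = 0 := hML hm k (hKV hk)
  have e : B (m + k) (m + k) = B m m := by
    simp only [map_add, add_apply, h1, hB k m, hKK k hk, add_zero]
  have hm0 : m = 0 := by
    by_contra h
    have := hC _ hxC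
    rw [e] at this
    exact (hM m hm h).not_ge this
  rw [hm0, zero_add] at hxC ⊢
  refine hR k (hKV hk) fun y => ?_
  -- `k` is orthogonal to `N'` and to `A ⊔ C = N'^⊥B`, and these two span the whole space
  obtain ⟨n, hn, hz⟩ := hNproj y
  have hyn : y - n ∈ A ⊔ C := hAC ▸ hz
  obtain ⟨a, ha, c, hc, hac⟩ := Submodule.mem_sup.1 hyn
  have e1 : B k n = 0 := hKL hk n (hN'V hn)
  have e2 : B k a = 0 := hCA hxC a ha
  have e3 : B k c = 0 := apply_eq_zero_of_nonneg hB hC hxC hc (hKK k hk)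
  rw [← sub_add_cancel y n, ← hac, map_add, map_add, e1, e2, e3, add_zero, add_zero]

end Count

/-! ### The negative part and a negative definite subspace -/

section Compare

variable {H : Type*} [NormedAddCommGroup H] [InnerProductSpace ℝ H]
  {B : H →L[ℝ] H →L[ℝ] ℝ} {T : H →L[ℝ] H} {N : ClosedSubmodule ℝ H}

/-- If `N` is the negative part of the form and `N'` a nonpositive subspace, then `B` is
nonnegative on the part of `N'^⊥B` that is `B`-orthogonal to `N ∩ N'^⊥B`. The projection to `N` of
a vector `y` of that part is a limit of projections of vectors of `N'`. -/
theorem IsNegativePart.nonneg_of_orthogonal [CompleteSpace H]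
    (hBT : ∀ x y, B x y = ⟪T x, y⟫_ℝ)
    (hB : ∀ x y, B x y = B y x) (hN : IsNegativePart T N) {N' : Submodule ℝ H}
    (hN' : ∀ x ∈ N', B x x ≤ 0) {y : H} (hy : y ∈ bilinOrthogonal B N')
    (hyA : y ∈ bilinOrthogonal B (N.toSubmodule ⊓ bilinOrthogonal B N')) : 0 ≤ B y y := by
  set p := N.toSubmodule.starProjection with hp
  have hpN : ∀ x, p x ∈ N := fun x => Submodule.starProjection_apply_mem _ x
  have hps : ∀ x z, ⟪p x, z⟫_ℝ = ⟪x, p z⟫_ℝ :=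
    fun x z => Submodule.inner_starProjection_left_eq_right _ _ _
  have hcl : p y ∈ closure (N'.map p.toLinearMap : Set H) := by
    rw [← Submodule.topologicalClosure_coe, SetLike.mem_coe,
      ← Submodule.orthogonal_orthogonal_eq_closure, Submodule.mem_orthogonal']
    intro z hz
    obtain ⟨w, hw, hwz⟩ := hN.surj _ (hpN z)
    have hwA : w ∈ bilinOrthogonal B N' := by
      intro n hn
      rw [hBT, hwz, hps]
      exact (Submodule.mem_orthogonal' _ _).1 hz _ ⟨n, hn, rfl⟩
    rw [hps, ← hwz, real_inner_comm, ← hBT, hB]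
    exact hyA w ⟨hw, hwA⟩
  have hclosed : IsClosed {v : H | B (p y - v) (p y - v) ≤ B y y} :=
    isClosed_le (by fun_prop) continuous_const
  have hsub : (N'.map p.toLinearMap : Set H) ⊆ {v : H | B (p y - v) (p y - v) ≤ B y y} := by
    rintro _ ⟨n, hn, rfl⟩
    change B (p y - p n) (p y - p n) ≤ B y y
    rw [← map_sub p]
    set d := y - n with hd
    have hr := N.toSubmodule.sub_starProjection_mem_orthogonal d
    rw [← hp] at hr
    have e1 : B (p d) (d - p d) = 0 := by
      rw [hBT]
      exact (Submodule.mem_orthogonal _ _).1 hr _ (hN.map_mem _ (hpN d))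
    have e2 : B d d = B (p d) (p d) + B (d - p d) (d - p d) := by
      conv_lhs => rw [← add_sub_cancel (p d) d]
      rw [map_add, map_add, add_apply, add_apply, e1, hB (d - p d) (p d), e1, add_zero, zero_add]
    have e3 : B d d = B y y + B n n := by
      have h1 := hy n hn
      rw [hd]
      simp only [map_sub, sub_apply, h1, hB n y]
      ring
    have e4 : 0 ≤ B (d - p d) (d - p d) := by rw [hBT]; exact hN.nonneg _ hr
    linarith [hN' n hn]
  have h := hclosed.closure_subset_iff.2 hsub hcl
  simpa using h

/-- `T` maps `N ∩ N'^⊥B` isomorphically to `N ∩ N'ᗮ`. -/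
theorem IsNegativePart.map_inf_bilinOrthogonal (hBT : ∀ x y, B x y = ⟪T x, y⟫_ℝ)
    (hN : IsNegativePart T N) (N' : Submodule ℝ H) :
    (N.toSubmodule ⊓ bilinOrthogonal B N').map T.toLinearMap = N.toSubmodule ⊓ N'ᗮ := by
  apply le_antisymm
  · rintro _ ⟨x, ⟨hx, hx'⟩, rfl⟩
    refine ⟨hN.map_mem x hx, (Submodule.mem_orthogonal' _ _).2 fun u hu => ?_⟩
    exact (hBT x u).symm.trans (hx' u hu)
  · rintro z ⟨hz, hz'⟩
    obtain ⟨x, hx, rfl⟩ := hN.surj z hz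
    refine ⟨x, ⟨hx, fun u hu => ?_⟩, rfl⟩
    rw [hBT]
    exact (Submodule.mem_orthogonal' _ _).1 hz' u hu

theorem IsNegativePart.finrank_inf_bilinOrthogonal (hBT : ∀ x y, B x y = ⟪T x, y⟫_ℝ)
    (hN : IsNegativePart T N) (N' : Submodule ℝ H) :
    Module.finrank ℝ ↥(N.toSubmodule ⊓ N'ᗮ) =
      Module.finrank ℝ ↥(N.toSubmodule ⊓ bilinOrthogonal B N') := by
  rw [← hN.map_inf_bilinOrthogonal hBT, ← LinearMap.range_domRestrict]
  refine LinearMap.finrank_range_of_inj ?_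
  rw [← LinearMap.ker_eq_bot, LinearMap.ker_eq_bot']
  intro x hx
  by_contra h
  have h1 := hN.neg_def x x.2.1 fun h' => h (Subtype.ext h')
  have h2 : T x = 0 := hx
  rw [h2, inner_zero_left] at h1
  exact h1.false

end Compare

/-! ### Self-adjoint Fredholm operators -/

section Fredholm

variable {H : Type*} [NormedAddCommGroup H] [InnerProductSpace ℝ H]
  {T : H →L[ℝ] H}

theorem finiteDimensional_orthogonal (V : Submodule ℝ H)
    (hV : FiniteDimensional ℝ (H ⧸ V)) : FiniteDimensional ℝ Vᗮ :=
  Module.Finite.iff_fg.2 (Submodule.CoFG.fg_of_disjoint V.orthogonal_disjoint.symm hV)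

variable [CompleteSpace H]

/-- A self-adjoint operator with closed range maps both definite parts of its spectral splitting
onto themselves. -/
theorem IsSpectralSplitting.surj {N P : ClosedSubmodule ℝ H} (h : IsSpectralSplitting T N P)
    (hT : IsSelfAdjoint T) (hcl : IsClosed (T.range : Set H)) :
    (∀ x ∈ N, ∃ y ∈ N, T y = x) ∧ ∀ x ∈ P, ∃ y ∈ P, T y = x := by
  have hrange : T.kerᗮ = T.range := by
    rw [T.orthogonal_ker, ContinuousLinearMap.isSelfAdjoint_iff'.1 hT]
    exact hcl.submodule_topologicalClosure_eq
  have hdec : ∀ x ∈ T.kerᗮ, ∃ a ∈ N, ∃ b ∈ P, T a + T b = x := by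
    intro x hx
    rw [hrange] at hx
    obtain ⟨y, rfl⟩ := hx
    have hy : y ∈ N.toSubmodule ⊔ P.toSubmodule ⊔ T.ker := by rw [h.sup_eq_top]; trivial
    obtain ⟨w, hw, k, hk, rfl⟩ := Submodule.mem_sup.1 hy
    obtain ⟨a, ha, b, hb, rfl⟩ := Submodule.mem_sup.1 hw
    refine ⟨a, ha, b, hb, ?_⟩
    have hk' : T k = 0 := hk
    change _ = T (a + b + k)
    rw [map_add, map_add, hk', add_zero]
  have hdisj : ∀ z, z ∈ N → z ∈ P → z = 0 := fun z h1 h2 =>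
    inner_self_eq_zero.1 ((Submodule.isOrtho_iff_inner_eq.1 h.ortho) z h1 z h2)
  constructor
  · intro x hx
    obtain ⟨a, ha, b, hb, e⟩ := hdec x (h.ortho_neg_ker.le hx)
    refine ⟨a, ha, ?_⟩
    have hTb : T b = 0 := by
      refine hdisj _ ?_ (h.map_pos b hb)
      rw [← eq_sub_iff_add_eq'] at e
      rw [e]
      exact N.toSubmodule.sub_mem hx (h.map_neg a ha)
    rw [← e, hTb, add_zero]
  · intro x hx
    obtain ⟨a, ha, b, hb, e⟩ := hdec x (h.ortho_pos_ker.le hx)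
    refine ⟨b, hb, ?_⟩
    have hTa : T a = 0 := by
      refine hdisj _ (h.map_neg a ha) ?_
      rw [← eq_sub_iff_add_eq] at e
      rw [e]
      exact P.toSubmodule.sub_mem hx (h.map_pos b hb)
    rw [← e, hTa, zero_add]

theorem IsSpectralSplitting.isNegativePart {N P : ClosedSubmodule ℝ H}
    (h : IsSpectralSplitting T N P) (hT : IsSelfAdjoint T) (hcl : IsClosed (T.range : Set H)) :
    IsNegativePart T N where
  map_mem := h.map_neg
  surj := (h.surj hT hcl).1
  neg_def := h.neg_def
  nonneg := by
    intro x hx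
    have hx' : x ∈ N.toSubmodule ⊔ P.toSubmodule ⊔ T.ker := by rw [h.sup_eq_top]; trivial
    obtain ⟨w, hw, k, hk, rfl⟩ := Submodule.mem_sup.1 hx'
    obtain ⟨a, ha, b, hb, rfl⟩ := Submodule.mem_sup.1 hw
    have e1 : ⟪a, b⟫_ℝ = 0 := Submodule.isOrtho_iff_inner_eq.1 h.ortho a ha b hb
    have e2 : ⟪a, k⟫_ℝ = 0 := Submodule.isOrtho_iff_inner_eq.1 h.ortho_neg_ker a ha k hk
    have e3 : ⟪T b, k⟫_ℝ = 0 :=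
      Submodule.isOrtho_iff_inner_eq.1 h.ortho_pos_ker _ (h.map_pos b hb) k hk
    have ha0 : a = 0 := by
      have h1 := (Submodule.mem_orthogonal _ _).1 hx a ha
      rw [inner_add_right, inner_add_right, e1, e2, add_zero, add_zero] at h1
      exact inner_self_eq_zero.1 h1
    have hk' : T k = 0 := hk
    rw [ha0, zero_add, map_add, hk', add_zero, inner_add_right, e3, add_zero]
    rcases eq_or_ne b 0 with rfl | hb0
    · simp
    · exact (h.pos_def b hb hb0).le

theorem isSelfAdjoint_associatedOperator {B : H →L[ℝ] H →L[ℝ] ℝ} (hB : ∀ x y, B x y = B y x) :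
    IsSelfAdjoint (associatedOperator B) := by
  rw [ContinuousLinearMap.isSelfAdjoint_iff_isSymmetric]
  intro x y
  change ⟪associatedOperator B x, y⟫_ℝ = ⟪x, associatedOperator B y⟫_ℝ
  rw [real_inner_comm (associatedOperator B y) x, inner_associatedOperator,
    inner_associatedOperator, hB]

open LinearMap in
/-- The compression of a Fredholm operator to a closed subspace of finite codimension is
Fredholm. -/
theorem isFredholm_restrictOperator (hT : T.IsFredholm) (V : ClosedSubmodule ℝ H)
    (hV : FiniteDimensional ℝ (H ⧸ V.toSubmodule)) : (restrictOperator T V).IsFredholm := by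
  obtain ⟨S, hS⟩ := hT.exists_isQuasiInverse
  have := finiteDimensional_orthogonal V.toSubmodule hV
  have hVq : V.toSubmodule.subtype.IsQuasiInverse
      V.toSubmodule.orthogonalProjectionOnto.toLinearMap :=
    isQuasiInverse_subtype_projectionOnto V.toSubmodule.isCompl_orthogonal
  exact .of_isQuasiInverse (v := V.toSubmodule.orthogonalProjectionOnto ∘L S ∘L
    V.toSubmodule.subtypeL) ((hVq.symm.comp hS).comp hVq)

end Fredholm

/-! ### Restriction to a subspace of finite codimension -/

section Restrict

variable {H : Type*} [NormedAddCommGroup H] [InnerProductSpace ℝ H]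

theorem mem_includeSubspace {V : ClosedSubmodule ℝ H} {W : ClosedSubmodule ℝ V.toSubmodule}
    {x : H} [CompleteSpace H] : x ∈ includeSubspace V W ↔ ∃ v ∈ W, (v : H) = x := by
  rw [← ClosedSubmodule.mem_toSubmodule_iff, toSubmodule_includeSubspace]
  exact Submodule.mem_map

theorem finiteDimensional_bilinOrthogonal {B : H →L[ℝ] H →L[ℝ] ℝ} {T : H →L[ℝ] H}
    (hBT : ∀ x y, B x y = ⟪T x, y⟫_ℝ) (hker : FiniteDimensional ℝ T.ker) {V : Submodule ℝ H}
    (hV : FiniteDimensional ℝ (H ⧸ V)) : FiniteDimensional ℝ ↥(bilinOrthogonal B V) := by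
  have := finiteDimensional_orthogonal V hV
  have hle : (bilinOrthogonal B V).map T.toLinearMap ≤ Vᗮ := by
    rintro _ ⟨x, hx, rfl⟩
    exact (Submodule.mem_orthogonal' _ _).2 fun u hu => (hBT x u).symm.trans (hx u hu)
  refine Module.Finite.iff_fg.2 (Submodule.fg_of_fg_map_of_fg_inf_ker T.toLinearMap ?_ ?_)
  · exact Module.Finite.iff_fg.1 (Submodule.finiteDimensional_of_le hle)
  · exact Module.Finite.iff_fg.1 (Submodule.finiteDimensional_of_le inf_le_right)

variable [CompleteSpace H] {T : H →L[ℝ] H} {V : ClosedSubmodule ℝ H}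

theorem inner_restrictOperator (v w : V.toSubmodule) :
    ⟪restrictOperator T V v, w⟫_ℝ = ⟪T v, (w : H)⟫_ℝ :=
  Submodule.inner_orthogonalProjectionOnto_eq_of_mem_right w (T v)

/-- The operator `P_V T P_V` on the whole space has the same negative part as the compression of
`T` to `V`. -/
theorem isNegativePart_includeSubspace {W : ClosedSubmodule ℝ V.toSubmodule}
    (hW : IsNegativePart (restrictOperator T V) W) :
    IsNegativePart (V.toSubmodule.starProjection * T * V.toSubmodule.starProjection)
      (includeSubspace V W) := by
  have hS : ∀ v : V.toSubmodule, (V.toSubmodule.starProjection * T *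
      V.toSubmodule.starProjection) v = restrictOperator T V v := by
    intro v
    change V.toSubmodule.starProjection (T (V.toSubmodule.starProjection v)) = _
    rw [Submodule.starProjection_eq_self_iff.2 v.2]
    rfl
  refine ⟨?_, ?_, ?_, ?_⟩
  · intro x hx
    obtain ⟨v, hv, rfl⟩ := mem_includeSubspace.1 hx
    exact mem_includeSubspace.2 ⟨_, hW.map_mem v hv, (hS v).symm⟩
  · intro x hx
    obtain ⟨v, hv, rfl⟩ := mem_includeSubspace.1 hx
    obtain ⟨w, hw, hwv⟩ := hW.surj v hv
    exact ⟨w, mem_includeSubspace.2 ⟨w, hw, rfl⟩, by rw [hS, hwv]⟩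
  · intro x hx hx0
    obtain ⟨v, hv, rfl⟩ := mem_includeSubspace.1 hx
    rw [hS]
    exact hW.neg_def v hv fun h => hx0 (by rw [h]; rfl)
  · intro x hx
    set v := V.toSubmodule.orthogonalProjectionOnto x with hv
    have hvx : (v : H) = V.toSubmodule.starProjection x := rfl
    have hvW : v ∈ W.toSubmoduleᗮ := by
      rw [Submodule.mem_orthogonal']
      intro w hw
      have h1 : ⟪v, w⟫_ℝ = ⟪x, (w : H)⟫_ℝ :=
        Submodule.inner_orthogonalProjectionOnto_eq_of_mem_right w x
      rw [h1]
      exact (Submodule.mem_orthogonal' _ _).1 hx w (mem_includeSubspace.2 ⟨w, hw, rfl⟩)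
    have h2 := hW.nonneg v hvW
    rw [inner_restrictOperator, hvx] at h2
    change 0 ≤ ⟪V.toSubmodule.starProjection (T (V.toSubmodule.starProjection x)), x⟫_ℝ
    rwa [Submodule.inner_starProjection_left_eq_right]

theorem isCompactOperator_sub_compression (T : H →L[ℝ] H) (V : ClosedSubmodule ℝ H)
    (hV : FiniteDimensional ℝ (H ⧸ V.toSubmodule)) : IsCompactOperator
      (T - V.toSubmodule.starProjection * T * V.toSubmodule.starProjection) := by
  have := finiteDimensional_orthogonal V.toSubmodule hV
  have hfin : IsCompactOperator V.toSubmoduleᗮ.starProjection := by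
    have : LocallyCompactSpace V.toSubmoduleᗮ := .of_finiteDimensional_of_complete ℝ _
    have h : IsCompactOperator (V.toSubmoduleᗮ.orthogonalProjectionOnto) :=
      isCompactOperator_of_locallyCompactSpace_dom _
    exact h.clm_comp V.toSubmoduleᗮ.subtypeL
  have hsub : V.toSubmoduleᗮ.starProjection = 1 - V.toSubmodule.starProjection := by
    ext x; simp
  rw [hsub] at hfin
  set p := V.toSubmodule.starProjection
  have e : T - p * T * p = T * (1 - p) + (1 - p) * (T * p) := by noncomm_ring
  rw [e]
  exact (hfin.clm_comp T).add (hfin.comp_clm (T * p))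

/-- If `A` maps `W` onto itself, every functional `⟪v, ·⟫` on `W` is of the form `⟪A n, ·⟫` with
`n ∈ W`. -/
theorem exists_inner_sub_eq_zero {A : H →L[ℝ] H} {W : ClosedSubmodule ℝ H}
    (hsurj : ∀ x ∈ W, ∃ y ∈ W, A y = x) (v : H) : ∃ n ∈ W, ∀ m ∈ W, ⟪v - A n, m⟫_ℝ = 0 := by
  obtain ⟨n, hn, e⟩ := hsurj _ (W.toSubmodule.starProjection_apply_mem v)
  refine ⟨n, hn, fun m hm => ?_⟩
  rw [e]
  exact (Submodule.mem_orthogonal' _ _).1 (W.toSubmodule.sub_starProjection_mem_orthogonal v) m hm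

theorem exists_bilin_projection_includeSubspace {B : H →L[ℝ] H →L[ℝ] ℝ}
    (hBT : ∀ x y, B x y = ⟪T x, y⟫_ℝ) {W : ClosedSubmodule ℝ V.toSubmodule}
    (hsurj : ∀ x ∈ W, ∃ y ∈ W, restrictOperator T V y = x) (x : H) :
    ∃ n ∈ includeSubspace V W, ∀ z ∈ includeSubspace V W, B (x - n) z = 0 := by
  obtain ⟨n, hn, h⟩ :=
    exists_inner_sub_eq_zero hsurj (V.toSubmodule.orthogonalProjectionOnto (T x))
  refine ⟨n, mem_includeSubspace.2 ⟨n, hn, rfl⟩, fun z hz => ?_⟩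
  obtain ⟨m, hm, rfl⟩ := mem_includeSubspace.1 hz
  have h1 := h m hm
  rw [inner_sub_left, inner_restrictOperator] at h1
  have h2 : ⟪V.toSubmodule.orthogonalProjectionOnto (T x), m⟫_ℝ = ⟪T x, (m : H)⟫_ℝ :=
    Submodule.inner_orthogonalProjectionOnto_eq_of_mem_right m (T x)
  rw [hBT, map_sub, inner_sub_left, ← h2, h1]

theorem map_ker_restrictOperator {B : H →L[ℝ] H →L[ℝ] ℝ} (hBT : ∀ x y, B x y = ⟪T x, y⟫_ℝ) :
    (restrictOperator T V).ker.map V.toSubmodule.subtype =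
      V.toSubmodule ⊓ bilinOrthogonal B V.toSubmodule := by
  apply le_antisymm
  · rintro _ ⟨v, hv, rfl⟩
    refine ⟨v.2, fun y hy => ?_⟩
    have h1 : restrictOperator T V v = 0 := hv
    have h2 := inner_restrictOperator (T := T) v ⟨y, hy⟩
    rw [h1, inner_zero_left] at h2
    exact (hBT v y).trans h2.symm
  · rintro x ⟨hx, hx'⟩
    refine ⟨⟨x, hx⟩, ?_, rfl⟩
    refine ext_inner_right (𝕜 := ℝ) (x := restrictOperator T V ⟨x, hx⟩) (y := 0) fun w => ?_
    rw [inner_restrictOperator, inner_zero_left]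
    exact (hBT x w).symm.trans (hx' w w.2)

end Restrict

/-! ### The index formula -/

theorem proposition3p18 {H : Type*} [NormedAddCommGroup H] [InnerProductSpace ℝ H]
    [CompleteSpace H] (B : H →L[ℝ] H →L[ℝ] ℝ) (hB : IsSymmetricFredholmForm B)
    (V : ClosedSubmodule ℝ H) (hV : FiniteDimensional ℝ (H ⧸ V.toSubmodule))
    (T : H →L[ℝ] H) (hT : T = associatedOperator B)
    (T' : V.toSubmodule →L[ℝ] V.toSubmodule) (hT' : T' = restrictOperator T V)
    (E E' : ClosedSubmodule ℝ H) (hE : E = negativeEigenspace T)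
    (hE' : E' = includeSubspace V (negativeEigenspace T')) :
    -- the restriction of `B` to `V` is a symmetric Fredholm form
    IsSymmetricFredholmForm (restrictForm B V.toSubmodule) ∧
    AreCommensurable E E' ∧
    -- all the dimensions in the formula are finite
    FiniteDimensional ℝ ↥(E.toSubmodule ⊓ E'.toSubmoduleᗮ) ∧
    FiniteDimensional ℝ ↥(E'.toSubmodule ⊓ E.toSubmoduleᗮ) ∧
    morseIndex (restrictForm B (bilinOrthogonal B V.toSubmodule)) ≠ ⊤ ∧
    FiniteDimensional ℝ ↥(V.toSubmodule ⊓ bilinOrthogonal B V.toSubmodule) ∧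
    FiniteDimensional ℝ ↥(V.toSubmodule ⊓ T.ker) ∧
    relativeDim E E' =
      ((morseIndex (restrictForm B (bilinOrthogonal B V.toSubmodule))).toNat : ℤ) +
        (Module.finrank ℝ ↥(V.toSubmodule ⊓ bilinOrthogonal B V.toSubmodule) : ℤ) -
        (Module.finrank ℝ ↥(V.toSubmodule ⊓ T.ker) : ℤ) := by
  have hBT : ∀ x y, B x y = ⟪T x, y⟫_ℝ := fun x y => by rw [hT, inner_associatedOperator]
  have hBs := hB.symm
  have hFred : T.IsFredholm := hT ▸ hB.fredholm
  have hTsa : IsSelfAdjoint T := hT ▸ isSelfAdjoint_associatedOperator hBs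
  have hTs : ∀ x y, ⟪T x, y⟫_ℝ = ⟪x, T y⟫_ℝ :=
    ContinuousLinearMap.isSelfAdjoint_iff_isSymmetric.1 hTsa
  have hassoc : associatedOperator (restrictForm B V.toSubmodule) = T' := by
    rw [associatedOperator_restrictForm, ← hT, hT']
  have hBsV : ∀ x y, restrictForm B V.toSubmodule x y = restrictForm B V.toSubmodule y x :=
    fun x y => hBs x y
  have hFred' : T'.IsFredholm := hT' ▸ isFredholm_restrictOperator hFred V hV
  have hTsa' : IsSelfAdjoint T' := hassoc ▸ isSelfAdjoint_associatedOperator hBsV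
  obtain ⟨P, hspl⟩ := negativeEigenspace_spec hTsa
  obtain ⟨P', hspl'⟩ := negativeEigenspace_spec hTsa'
  rw [← hE] at hspl
  set W := negativeEigenspace T' with hW
  have hN := hspl.isNegativePart hTsa hFred.isClosed_range
  have hN' := hspl'.isNegativePart hTsa' hFred'.isClosed_range
  have hsurj := hspl'.surj hTsa' hFred'.isClosed_range
  subst hT'
  have hBr : ∀ v w : V.toSubmodule, B v w = ⟪restrictOperator T V v, w⟫_ℝ := fun v w => by
    rw [hBT, inner_restrictOperator]
  have hNH := isNegativePart_includeSubspace hN'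
  rw [← hE'] at hNH
  have hcomm : AreCommensurable E E' := by
    refine hN.areCommensurable hTs (fun x y => ?_) hNH (isCompactOperator_sub_compression T V hV)
    change ⟪V.toSubmodule.starProjection (T (V.toSubmodule.starProjection x)), y⟫_ℝ =
      ⟪x, V.toSubmodule.starProjection (T (V.toSubmodule.starProjection y))⟫_ℝ
    rw [Submodule.inner_starProjection_left_eq_right, hTs,
      Submodule.inner_starProjection_left_eq_right]
  -- the spectral splitting of the compression, as a splitting of `V` inside `H`
  have memE' : ∀ x, x ∈ E' ↔ ∃ v ∈ W, (v : H) = x := fun x => by rw [hE', mem_includeSubspace]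
  have memP' : ∀ x, x ∈ includeSubspace V P' ↔ ∃ v ∈ P', (v : H) = x :=
    fun x => mem_includeSubspace
  have hK := map_ker_restrictOperator (V := V) hBT
  set K := V.toSubmodule ⊓ bilinOrthogonal B V.toSubmodule with hKdef
  have hsup : E'.toSubmodule ⊔ (includeSubspace V P').toSubmodule ⊔ K = V.toSubmodule := by
    rw [hE', toSubmodule_includeSubspace, toSubmodule_includeSubspace, ← hK, ← Submodule.map_sup,
      ← Submodule.map_sup, hspl'.sup_eq_top, Submodule.map_subtype_top]
  have hE'V : E'.toSubmodule ≤ V.toSubmodule := hsup ▸ le_sup_left.trans le_sup_left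
  have hEneg : ∀ x ∈ E.toSubmodule, x ≠ 0 → B x x < 0 := fun x hx h0 => by
    rw [hBT]; exact hN.neg_def x hx h0
  have hE'neg : ∀ x ∈ E'.toSubmodule, x ≠ 0 → B x x < 0 := by
    rintro x hx h0
    obtain ⟨v, hv, rfl⟩ := (memE' x).1 hx
    rw [hBr]
    exact hN'.neg_def v hv fun h => h0 (by rw [h]; rfl)
  have hE'nonpos : ∀ x ∈ E'.toSubmodule, B x x ≤ 0 := fun x hx => by
    rcases eq_or_ne x 0 with rfl | h0
    · simp
    · exact (hE'neg x hx h0).le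
  have hP'nonneg : ∀ x ∈ (includeSubspace V P').toSubmodule, 0 ≤ B x x := by
    rintro x hx
    obtain ⟨v, hv, rfl⟩ := (memP' x).1 hx
    rw [hBr]
    rcases eq_or_ne v 0 with rfl | h0
    · simp
    · exact (hspl'.pos_def v hv h0).le
  have hPE : ∀ x ∈ (includeSubspace V P').toSubmodule, ∀ y ∈ E'.toSubmodule, B x y = 0 := by
    intro x hx y hy
    obtain ⟨v, hv, rfl⟩ := (memP' x).1 hx
    obtain ⟨w, hw, rfl⟩ := (memE' y).1 hy
    rw [hBr, real_inner_comm]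
    exact Submodule.isOrtho_iff_inner_eq.1 hspl'.ortho w hw _ (hspl'.map_pos v hv)
  have hE'proj : ∀ x, ∃ n ∈ E'.toSubmodule, ∀ z ∈ E'.toSubmodule, B (x - n) z = 0 := by
    rw [hE']; exact exists_bilin_projection_includeSubspace hBT hsurj.1
  have hP'proj : ∀ x, ∃ n ∈ (includeSubspace V P').toSubmodule,
      ∀ z ∈ (includeSubspace V P').toSubmodule, B (x - n) z = 0 :=
    exists_bilin_projection_includeSubspace hBT hsurj.2
  have hker := hFred.finite_ker
  have hLfin := finiteDimensional_bilinOrthogonal hBT hker hV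
  have hKfin : FiniteDimensional ℝ K := Submodule.finiteDimensional_of_le inf_le_right
  have hRfin : FiniteDimensional ℝ ↥(V.toSubmodule ⊓ T.ker) :=
    Submodule.finiteDimensional_of_le inf_le_right
  -- `B` is negative on `E'` and nonnegative on `Eᗮ`
  have hbot : E'.toSubmodule ⊓ E.toSubmoduleᗮ = ⊥ := by
    rw [eq_bot_iff]
    rintro x ⟨hx, hx'⟩
    exact eq_zero_of_neg_of_nonneg hE'neg (C := E.toSubmoduleᗮ)
      (fun y hy => by rw [hBT]; exact hN.nonneg y hy) hx hx'
  set A := E.toSubmodule ⊓ bilinOrthogonal B E'.toSubmodule with hA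
  have hAneg : ∀ x ∈ A, x ≠ 0 → B x x < 0 := fun x hx => hEneg x hx.1
  have hAV : A ⊓ V.toSubmodule = ⊥ := by
    rw [eq_bot_iff]
    rintro x ⟨hxA, hxV⟩
    have hx' : (⟨x, hxV⟩ : V.toSubmodule) ∈ W.toSubmoduleᗮ := by
      rw [Submodule.mem_orthogonal]
      intro u hu
      obtain ⟨w, hw, rfl⟩ := hN'.surj u hu
      rw [← hBr, hBs]
      exact hxA.2 w ((memE' w).2 ⟨w, hw, rfl⟩)
    have h1 := hN'.nonneg _ hx'
    rw [← hBr] at h1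
    by_contra h0
    exact (hAneg x hxA h0).not_ge h1
  have hAfin : FiniteDimensional ℝ A :=
    Module.Finite.iff_fg.2 (Submodule.CoFG.fg_of_disjoint (disjoint_iff.2 hAV) hV)
  have hmap := hN.map_inf_bilinOrthogonal hBT E'.toSubmodule
  have hdimA := hN.finrank_inf_bilinOrthogonal hBT E'.toSubmodule
  rw [← hA] at hdimA
  obtain ⟨M, C, hMC, hM, hC⟩ := exists_neg_sup_nonneg hBs (bilinOrthogonal B V.toSubmodule)
  have hMfin : FiniteDimensional ℝ M := Submodule.finiteDimensional_of_le (hMC ▸ le_sup_left)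
  have hmorse := morseIndex_restrictForm hMC hM hC
  have hupper := finrank_add_finrank_le_of_neg hBs hsup hPE hP'nonneg hP'proj hKdef
    (R := V.toSubmodule ⊓ T.ker) (A := A) (M := M) (C := C)
    (fun x hx => ⟨hx.1, fun y _ => by
      rw [hBT, show T x = 0 from hx.2, inner_zero_left]⟩)
    (fun x hx y => by rw [hBT, show T x = 0 from hx.2, inner_zero_left])
    hMC hC hAneg inf_le_right
  have hAsup : A ⊔ (bilinOrthogonal B E'.toSubmodule ⊓ bilinOrthogonal B A) =
      bilinOrthogonal B E'.toSubmodule := by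
    refine le_antisymm (sup_le inf_le_right inf_le_left) fun x hx => ?_
    obtain ⟨a, ha, hz⟩ := exists_bilin_projection hAneg x
    exact Submodule.mem_sup.2 ⟨a, ha, x - a,
      ⟨Submodule.sub_mem _ hx ha.2, hz⟩, add_sub_cancel _ _⟩
  have hlower := finrank_add_finrank_le_of_nonneg_compl hBs hE'V hE'proj hKdef
    (R := V.toSubmodule ⊓ T.ker) (A := A) (M := M)
    (fun x hx h => ⟨hx, by
      have h1 := h (T x)
      rw [hBT] at h1
      exact inner_self_eq_zero.1 h1⟩)
    (hMC ▸ le_sup_left) hM hAsup inf_le_right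
    (fun y hy => hN.nonneg_of_orthogonal hBT hBs hE'nonpos hy.1 hy.2)
  refine ⟨⟨hBsV, hassoc ▸ hFred'⟩, hcomm, ?_, ?_, ?_, hKfin, hRfin, ?_⟩
  · rw [← hmap]; infer_instance
  · rw [hbot]; infer_instance
  · rw [hmorse]; exact ENat.natCast_ne_top _
  · unfold relativeDim
    rw [hbot, finrank_bot, hdimA, hmorse, ENat.toNat_natCast]
    omega
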